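/- Let $\lambda>0$ and $0<\theta\le \pi/4$. Let $\mathcal P_\lambda$ be a homogeneous Poisson point process on $\mathbb R^2$ with intensity $\lambda$, defined on a probability space with probability measure $\mathbb P$. For $v\in\mathbb R^2$ let $$\mathcal C_\theta(v):=\{v+(r\cos\varphi,r\sin\varphi)\colon r>0,\ |\varphi|\le\theta\}.$$ Define the waypoints of the directed-$\theta$-navigation by $V_0:=o=(0,0)$ and $$V_{i+1}:=\operatorname{argmin}\{|v-V_i|\colon v\in\mathcal P_\lambda\cap\mathcal C_\theta(V_i)\},\qquad i\ge 0$$ (almost surely, the argmin exists and is unique). For $t\ge 0$ let $\mathcal Y_t$ be the second coordinate of the (almost surely unique) point with first coordinate $t$ on the interpolated trajectory $\bigcup_{k\ge 0}[V_k,V_{k+1}]$, where $[V_k,V_{k+1}]$ is the line segment between $V_k$ and $V_{k+1}$. For $\gamma,u\in\mathbb R^2$ set $$J_{\lambda,\theta}(\gamma):=\log\Big(\lambda\int_0^\infty r\,e^{-\lambda\theta r^2}\int_{-\theta}^{\theta}e^{\gamma_1 r\cos\varphi+\gamma_2 r\sin\varphi}\,\mathrm d\varphi\,\mathrm dr\Big),\qquad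 \mathcal I_{\lambda,\theta}(u):=\sup_{\gamma\in\mathbb R^2}\big(\langle\gamma,u\rangle-J_{\lambda,\theta}(\gamma)\big)\in[0,\infty],$$ and for $x\in\mathbb R$ set $$I_{\lambda,\theta}(x):=\inf\{\beta\,\mathcal I_{\lambda,\theta}(1/\beta,x/\beta)\colon \beta>0\}.$$ Then $\{t^{-1}\mathcal Y_t\}$ satisfies, as $t\to\infty$, the large-deviation principle with speed $t$ and rate function $I_{\lambda,\theta}$. That is, $I_{\lambda,\theta}\colon\mathbb R\to[0,\infty]$ is lower semicontinuous, and for all closed $F\subset\mathbb R$ and all open $O\subset\mathbb R$, $$\limsup_{t\to\infty}\tfrac1t\log\mathbb P(t^{-1}\mathcal Y_t\in F)\le-\inf_{x\in F}I_{\lambda,\theta}(x),\qquad \liminf_{t\to\infty}\tfrac1t\log\mathbb P(t^{-1}\mathcal Y_t\in O)\ge-\inf_{x\in O}I_{\lambda,\theta}(x).$$ Moreover, $I_{\lambda,\theta}(x)=\sqrt\lambda\,I_{1,\theta}(x)$ for all $x\in\mathbb R$. -/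

import Mathlib

open MeasureTheory ProbabilityTheory Filter

noncomputable section

namespace Navigation

/-- The Euclidean plane. -/
abbrev Plane : Type := EuclideanSpace ℝ (Fin 2)

/-- `Φ` is a homogeneous Poisson point process on the plane with intensity `l`, as a random set of
points on the probability space `(Ω, P)`: the number of points in every Borel set is a random
variable, it is Poisson distributed with mean `l * |A|` whenever the area `|A|` is finite, and the
numbers of points in pairwise disjoint Borel sets are independent. -/
structure IsPoissonProcess {Ω : Type*} [MeasurableSpace Ω] (P : Measure Ω) (l : ℝ)
    (Φ : Ω → Set Plane) : Prop where
  measurable_count : ∀ A : Set Plane, MeasurableSet A →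
    Measurable fun ω => (Φ ω ∩ A).encard
  map_count : ∀ A : Set Plane, MeasurableSet A → volume A ≠ ⊤ →
    P.map (fun ω => (Φ ω ∩ A).encard)
      = (poissonMeasure (l * volume.real A).toNNReal).map (fun k : ℕ => (k : ℕ∞))
  indep_count : ∀ (n : ℕ) (A : Fin n → Set Plane), (∀ i, MeasurableSet (A i)) →
    Pairwise (fun i j => Disjoint (A i) (A j)) →
    iIndepFun (fun i ω => (Φ ω ∩ A i).encard) P

/-- The cone of opening angle `2 * θ` around the first unit vector with apex `v` (apex excluded):
the points `v + r (cos φ, sin φ)` with `r > 0` and `|φ| ≤ θ`. -/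
def cone (θ : ℝ) (v : Plane) : Set Plane :=
  {w | ∃ r φ : ℝ, 0 < r ∧ |φ| ≤ θ ∧ w = v + !₂[r * Real.cos φ, r * Real.sin φ]}

/-- `w` minimizes the Euclidean distance to `v` among the points of `S` in the cone with
apex `v`. -/
def IsSuccessor (θ : ℝ) (S : Set Plane) (v w : Plane) : Prop :=
  w ∈ S ∩ cone θ v ∧ ∀ z ∈ S ∩ cone θ v, dist w v ≤ dist z v

open Classical in
/-- The successor of `v`, i.e. the argmin of the distance to `v` over `S ∩ cone θ v`
(the value is `v` if there is no minimizer, which has probability zero for a Poisson process). -/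
def successor (θ : ℝ) (S : Set Plane) (v : Plane) : Plane :=
  if h : ∃ w, IsSuccessor θ S v w then h.choose else v

/-- The waypoints `V 0 = 0`, `V (i + 1) = ` successor of `V i`, of the directed navigation. -/
def waypoint (θ : ℝ) (S : Set Plane) : ℕ → Plane
  | 0 => 0
  | i + 1 => successor θ S (waypoint θ S i)

/-- The interpolated trajectory: the union of the segments between consecutive waypoints. -/
def trajectory (θ : ℝ) (S : Set Plane) : Set Plane :=
  ⋃ k : ℕ, segment ℝ (waypoint θ S k) (waypoint θ S (k + 1))

open Classical in
/-- The vertical displacement at horizontal progress `t`: the second coordinate of the point of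
the interpolated trajectory whose first coordinate is `t` (and `0` if there is no such point). -/
def displacement (θ : ℝ) (S : Set Plane) (t : ℝ) : ℝ :=
  if h : ∃ y : ℝ, !₂[t, y] ∈ trajectory θ S then h.choose else 0

/-- The logarithmic moment generating function of a progress step, in polar coordinates. -/
def logMGF (l θ : ℝ) (γ : Plane) : ℝ :=
  Real.log (l * ∫ r in Set.Ioi (0 : ℝ), r * Real.exp (-(l * θ * r ^ 2)) *
    ∫ φ in (-θ)..θ, Real.exp (γ 0 * r * Real.cos φ + γ 1 * r * Real.sin φ))

/-- The Legendre transform of `logMGF`, with values in the extended reals. -/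
def stepRate (l θ : ℝ) (u : Plane) : EReal :=
  ⨆ γ : Plane, ((inner ℝ γ u - logMGF l θ γ : ℝ) : EReal)

/-- `x ↦ inf {β * stepRate (1 / β, x / β) : β > 0}`. -/
def rate (l θ : ℝ) (x : ℝ) : EReal :=
  ⨅ β : {β : ℝ // 0 < β}, ((β : ℝ) : EReal) * stepRate l θ !₂[1 / (β : ℝ), x / (β : ℝ)]

/-- The large-deviation principle, as `t → ∞`, for the random variables `Z t` with speed `s t` and
rate function `I` (nonnegative, lower semicontinuous). Here `ENNReal.log 0 = -∞`. -/
structure IsLDP {Ω X : Type*} [MeasurableSpace Ω] [TopologicalSpace X] (P : Measure Ω)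
    (Z : ℝ → Ω → X) (s : ℝ → ℝ) (I : X → EReal) : Prop where
  nonneg : ∀ x, 0 ≤ I x
  lowerSemicontinuous : LowerSemicontinuous I
  upper : ∀ F : Set X, IsClosed F →
    limsup (fun t : ℝ => (((s t)⁻¹ : ℝ) : EReal) * ENNReal.log (P {ω | Z t ω ∈ F})) atTop
      ≤ - ⨅ x ∈ F, I x
  lower : ∀ O : Set X, IsOpen O →
    - ⨅ x ∈ O, I x
      ≤ liminf (fun t : ℝ => (((s t)⁻¹ : ℝ) : EReal) * ENNReal.log (P {ω | Z t ω ∈ O})) atTop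

end Navigation

end

namespace Navigation

open Topology

/-! ### Void probabilities of a Poisson process -/

section Poisson

variable {Ω : Type*} [MeasurableSpace Ω] {P : Measure Ω} {l : ℝ} {Φ : Ω → Set Plane}

lemma IsPoissonProcess.prob_count_eq (hΦ : IsPoissonProcess P l Φ) {A : Set Plane}
    (hA : MeasurableSet A) (hfin : volume A ≠ ⊤) (s : Set ℕ∞) (hs : MeasurableSet s) :
    P {ω | (Φ ω ∩ A).encard ∈ s}
      = poissonMeasure (l * volume.real A).toNNReal ((fun k : ℕ => (k : ℕ∞)) ⁻¹' s) := by
  have h1 := hΦ.map_count A hA hfin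
  have h2 := congrArg (fun μ => μ s) h1
  rw [Measure.map_apply (hΦ.measurable_count A hA) hs,
    Measure.map_apply (measurable_of_countable _) hs] at h2
  exact h2

lemma IsPoissonProcess.prob_void (hΦ : IsPoissonProcess P l Φ) (hl : 0 ≤ l) {A : Set Plane}
    (hA : MeasurableSet A) (hfin : volume A ≠ ⊤) :
    P {ω | (Φ ω ∩ A).encard = 0} = ENNReal.ofReal (Real.exp (-(l * volume.real A))) := by
  have h := hΦ.prob_count_eq hA hfin {0} (measurableSet_singleton _)
  have h0 : (fun k : ℕ => (k : ℕ∞)) ⁻¹' {0} = {0} := by ext k; simp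
  rw [h0, poissonMeasure_singleton] at h
  simp only [Set.mem_singleton_iff] at h
  rw [h, Real.coe_toNNReal _ (mul_nonneg hl measureReal_nonneg)]
  simp

lemma IsPoissonProcess.ae_finite (hΦ : IsPoissonProcess P l Φ) {A : Set Plane}
    (hA : MeasurableSet A) (hfin : volume A ≠ ⊤) : ∀ᵐ ω ∂P, (Φ ω ∩ A).Finite := by
  have h := hΦ.prob_count_eq hA hfin {⊤} (measurableSet_singleton _)
  have h0 : (fun k : ℕ => (k : ℕ∞)) ⁻¹' {⊤} = ∅ := by ext k; simp
  rw [h0, measure_empty] at h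
  rw [ae_iff]
  refine (congrArg P (Set.ext fun ω => ?_)).trans h
  exact Set.encard_eq_top_iff.symm

lemma IsPoissonProcess.prob_hit_le [IsProbabilityMeasure P] (hΦ : IsPoissonProcess P l Φ)
    (hl : 0 ≤ l) {A : Set Plane} (hA : MeasurableSet A) (hfin : volume A ≠ ⊤) :
    P {ω | (Φ ω ∩ A).encard ≠ 0} ≤ ENNReal.ofReal l * volume A := by
  have h := hΦ.prob_void hl hA hfin
  have hm : MeasurableSet {ω | (Φ ω ∩ A).encard = 0} :=
    hΦ.measurable_count A hA (measurableSet_singleton 0)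
  have : {ω | (Φ ω ∩ A).encard ≠ 0} = {ω | (Φ ω ∩ A).encard = 0}ᶜ := rfl
  rw [this, prob_compl_eq_one_sub hm, h, ← ENNReal.ofReal_toReal hfin,
    ← ENNReal.ofReal_mul hl, ← ENNReal.ofReal_one,
    ← ENNReal.ofReal_sub _ (Real.exp_pos _).le]
  apply ENNReal.ofReal_le_ofReal
  have := Real.add_one_le_exp (-(l * volume.real A))
  rw [Measure.real] at *
  linarith

lemma IsPoissonProcess.prob_hit_void_le [IsProbabilityMeasure P] (hΦ : IsPoissonProcess P l Φ)
    (hl : 0 ≤ l) {n : ℕ} {A : Fin n → Set Plane} {D : Set Plane}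
    (hA : ∀ i, MeasurableSet (A i)) (hAfin : ∀ i, volume (A i) ≠ ⊤)
    (hdisj : Pairwise fun i j => Disjoint (A i) (A j))
    (hD : MeasurableSet D) (hDfin : volume D ≠ ⊤) (hAD : ∀ i, Disjoint D (A i)) :
    P {ω | (∀ i, (Φ ω ∩ A i).encard ≠ 0) ∧ (Φ ω ∩ D).encard = 0}
      ≤ (∏ i, ENNReal.ofReal l * volume (A i))
        * ENNReal.ofReal (Real.exp (-(l * volume.real D))) := by
  let B : Fin (n + 1) → Set Plane := Fin.cons D A
  have hB : ∀ i, MeasurableSet (B i) := by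
    intro i; refine Fin.cases ?_ (fun j => ?_) i
    · exact hD
    · exact hA j
  have hBd : Pairwise fun i j => Disjoint (B i) (B j) := by
    intro i j
    refine Fin.cases ?_ (fun i => ?_) i <;> refine Fin.cases ?_ (fun j => ?_) j
    · intro h; exact absurd rfl h
    · intro _; exact hAD j
    · intro _; exact (hAD i).symm
    · intro h; exact hdisj (fun e => h (congrArg Fin.succ e))
  have hind := hΦ.indep_count (n + 1) B hB hBd
  let S : Fin (n + 1) → Set ℕ∞ := Fin.cons {0} (fun _ => {0}ᶜ)
  have hS : ∀ i, MeasurableSet (S i) := fun i => (Set.to_countable _).measurableSet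
  have hprod := hind.measure_inter_preimage_eq_mul Finset.univ (sets := S) (fun i _ => hS i)
  have hset : {ω | (∀ i, (Φ ω ∩ A i).encard ≠ 0) ∧ (Φ ω ∩ D).encard = 0}
      = ⋂ i ∈ (Finset.univ : Finset (Fin (n + 1))),
        (fun ω => (Φ ω ∩ B i).encard) ⁻¹' S i := by
    ext ω
    simp [B, S, Fin.forall_fin_succ, and_comm]
  rw [hset, hprod, Fin.prod_univ_succ, mul_comm]
  refine mul_le_mul' (Finset.prod_le_prod' fun i _ => ?_) ?_
  · exact hΦ.prob_hit_le hl (hA i) (hAfin i)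
  · exact (hΦ.prob_void hl hD hDfin).le

/-! ### A bound for the probability that a point pattern occurs with a void region -/

/-- A half-open grid cell of side `s`. -/
def gridCell (s : ℝ) (m : Fin 2 → ℤ) : Set Plane := {x | ∀ i, ⌊x i / s⌋ = m i}

lemma measurableSet_gridCell (s : ℝ) (m : Fin 2 → ℤ) : MeasurableSet (gridCell s m) := by
  have : gridCell s m = ⋂ i, {x : Plane | ⌊x i / s⌋ = m i} := by
    ext x; simp [gridCell]
  rw [this]
  refine MeasurableSet.iInter fun i => ?_
  have h : Measurable fun x : Plane => ⌊x i / s⌋ :=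
    Int.measurable_floor.comp (by fun_prop)
  exact h (measurableSet_singleton _)

lemma dist_le_of_mem_gridCell {s : ℝ} (hs : 0 < s) {m : Fin 2 → ℤ} {x y : Plane}
    (hx : x ∈ gridCell s m) (hy : y ∈ gridCell s m) : dist x y ≤ 2 * s := by
  have key : ∀ i, |x i - y i| ≤ s := by
    intro i
    have h := Int.abs_sub_lt_one_of_floor_eq_floor ((hx i).trans (hy i).symm)
    rw [← sub_div, abs_div, abs_of_pos hs, div_lt_one hs] at h
    exact h.le
  rw [EuclideanSpace.dist_eq, Fin.sum_univ_two]
  apply Real.sqrt_le_iff.2 ⟨by positivity, ?_⟩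
  simp only [Real.dist_eq]
  have h0 := key 0
  have h1 := key 1
  have := pow_le_pow_left₀ (abs_nonneg _) h0 2
  have := pow_le_pow_left₀ (abs_nonneg _) h1 2
  nlinarith

lemma volume_gridCell_le {h : ℝ} (hh : 0 < h) (m : Fin 2 → ℤ) :
    volume (gridCell (h / 2) m) ≤ ENNReal.ofReal (Real.pi * h ^ 2) := by
  rcases (gridCell (h / 2) m).eq_empty_or_nonempty with he | ⟨x, hx⟩
  · simp [he]
  · have hsub : gridCell (h / 2) m ⊆ Metric.closedBall x h := by
      intro y hy
      have := dist_le_of_mem_gridCell (by positivity) hy hx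
      rw [Metric.mem_closedBall]; linarith
    refine (measure_mono hsub).trans ?_
    rw [EuclideanSpace.volume_closedBall_fin_two, mul_comm, ENNReal.ofReal_mul Real.pi_pos.le,
      ENNReal.ofReal_pow hh.le]

/-- The points of `U` at distance more than `h` from the complement. -/
def erode {α : Type*} [PseudoEMetricSpace α] (h : ℝ) (U : Set α) : Set α :=
  {p | ENNReal.ofReal h < Metric.infEDist p Uᶜ}

lemma isOpen_erode {α : Type*} [PseudoEMetricSpace α] (h : ℝ) (U : Set α) :
    IsOpen (erode h U) :=
  isOpen_lt continuous_const Metric.continuous_infEDist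

lemma erode_anti {α : Type*} [PseudoEMetricSpace α] {h h' : ℝ} (hh : h ≤ h') (U : Set α) :
    erode h' U ⊆ erode h U := fun _ hp => (ENNReal.ofReal_le_ofReal hh).trans_lt hp

lemma mem_of_mem_erode {α : Type*} [PseudoMetricSpace α] {h : ℝ} {U : Set α}
    {p q : α} (hp : p ∈ erode h U) (hpq : dist p q ≤ h) : q ∈ U := by
  by_contra hq
  have h1 : Metric.infEDist p Uᶜ ≤ edist p q := Metric.infEDist_le_edist_of_mem hq
  rw [edist_dist] at h1
  exact absurd (h1.trans (ENNReal.ofReal_le_ofReal hpq)) (not_le.2 hp)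

lemma iUnion_erode {α : Type*} [PseudoMetricSpace α] {U : Set α} (hU : IsOpen U) :
    ⋃ k : ℕ, erode (1 / ((k : ℝ) + 1)) U = U := by
  apply Set.Subset.antisymm
  · refine Set.iUnion_subset fun k p hp => mem_of_mem_erode hp ?_
    rw [dist_self]; positivity
  · intro p hp
    have hpos : 0 < Metric.infEDist p Uᶜ := by
      rw [pos_iff_ne_zero]
      intro h0
      have := (Metric.mem_iff_infEDist_zero_of_closed hU.isClosed_compl).2 h0
      exact this hp
    have hlim : Tendsto (fun k : ℕ => ENNReal.ofReal (1 / ((k : ℝ) + 1))) atTop (𝓝 0) := by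
      have := ENNReal.tendsto_ofReal (tendsto_one_div_add_atTop_nhds_zero_nat (𝕜 := ℝ))
      simpa using this
    obtain ⟨k, hk⟩ := (hlim.eventually (gt_mem_nhds hpos)).exists
    exact Set.mem_iUnion.2 ⟨k, hk⟩

end Poisson

section Pattern

variable {Ω : Type*} [MeasurableSpace Ω] {P : Measure Ω} {l : ℝ} {Φ : Ω → Set Plane}

/-- The event that `Φ` contains a pattern from `T` whose associated region contains no point
of `Φ`. -/
def patternEvent (Φ : Ω → Set Plane) {n : ℕ} (D : Set ((Fin n → Plane) × Plane))
    (T : Set (Fin n → Plane)) : Set Ω :=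
  {ω | ∃ v ∈ T, (∀ i, v i ∈ Φ ω) ∧ ∀ z ∈ Φ ω, (v, z) ∉ D}

omit [MeasurableSpace Ω] in
lemma patternEvent_mono {n : ℕ} (D : Set ((Fin n → Plane) × Plane))
    {T T' : Set (Fin n → Plane)} (h : T ⊆ T') : patternEvent Φ D T ⊆ patternEvent Φ D T' :=
  fun _ ⟨v, hv, h1⟩ => ⟨v, h hv, h1⟩

lemma prob_patternEvent_cell_le [IsProbabilityMeasure P] (hΦ : IsPoissonProcess P l Φ)
    (hl : 0 ≤ l) {n : ℕ} {D : Set ((Fin n → Plane) × Plane)}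
    (hfin : ∀ v, volume (Prod.mk v ⁻¹' D) ≠ ⊤) {T : Set (Fin n → Plane)} {h : ℝ} (hh : 0 < h)
    (hsep : ∀ v ∈ T, ∀ i j, i ≠ j → h < dist (v i) (v j)) (m : Fin n → Fin 2 → ℤ) :
    P (patternEvent Φ D (T ∩ Set.univ.pi fun i => gridCell (h / 2) (m i)))
      ≤ ENNReal.ofReal (Real.exp (l * (n * (Real.pi * h ^ 2)))) *
        ∫⁻ v in (Set.univ.pi fun i => gridCell (h / 2) (m i)) ∩ Metric.cthickening h T,
          ENNReal.ofReal l ^ n *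
            ENNReal.ofReal (Real.exp (-(l * volume.real (Prod.mk v ⁻¹' erode h D)))) := by
  set Q : Set (Fin n → Plane) := Set.univ.pi fun i => gridCell (h / 2) (m i) with hQdef
  have hcell : ∀ i, MeasurableSet (gridCell (h / 2) (m i)) :=
    fun i => measurableSet_gridCell _ _
  have hcellfin : ∀ i, volume (gridCell (h / 2) (m i)) ≠ ⊤ := fun i =>
    ((volume_gridCell_le hh (m i)).trans_lt ENNReal.ofReal_lt_top).ne
  rcases (T ∩ Q).eq_empty_or_nonempty with he | ⟨v₀, hv₀T, hv₀Q⟩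
  · rw [he]
    have : patternEvent Φ D ∅ = ∅ := by ext ω; simp [patternEvent]
    simp [this]
  have hdistQ : ∀ v ∈ Q, ∀ w ∈ Q, dist v w ≤ h := by
    intro v hv w hw
    rw [dist_pi_le_iff hh.le]
    intro i
    have := dist_le_of_mem_gridCell (by positivity) (hv i trivial) (hw i trivial)
    linarith
  have hdisj : Pairwise fun i j => Disjoint (gridCell (h / 2) (m i)) (gridCell (h / 2) (m j)) := by
    intro i j hij
    rw [Set.disjoint_left]
    intro x hxi hxj
    have hm : m i = m j := funext fun a => (hxi a).symm.trans (hxj a)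
    have h1 := hsep v₀ hv₀T i j hij
    have hvj : v₀ j ∈ gridCell (h / 2) (m i) := by rw [hm]; exact hv₀Q j trivial
    have h2 := dist_le_of_mem_gridCell (by positivity) (hv₀Q i trivial) hvj
    linarith
  have hQT : Q ∩ Metric.cthickening h T = Q := by
    apply Set.inter_eq_left.2
    intro v hv
    exact Metric.mem_cthickening_of_dist_le v v₀ h T hv₀T (hdistQ v hv v₀ hv₀Q)
  rw [hQT]
  set DQ : Set Plane := ⋃ v ∈ Q, Prod.mk v ⁻¹' erode h D with hDQ
  have hDQopen : IsOpen DQ := isOpen_biUnion fun v _ =>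
    (isOpen_erode h D).preimage (by fun_prop)
  have hDQsub : ∀ v ∈ Q, DQ ⊆ Prod.mk v ⁻¹' D := by
    intro v hv z hz
    simp only [hDQ, Set.mem_iUnion] at hz
    obtain ⟨w, hw, hz⟩ := hz
    refine mem_of_mem_erode (p := (w, z)) hz ?_
    rw [Prod.dist_eq, dist_self]
    exact max_le (hdistQ w hw v hv) hh.le
  have hDQfin : volume DQ ≠ ⊤ := measure_ne_top_of_subset (hDQsub v₀ hv₀Q) (hfin v₀)
  set C : Set Plane := ⋃ i, gridCell (h / 2) (m i) with hC
  have hCm : MeasurableSet C := MeasurableSet.iUnion hcell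
  have hsub : patternEvent Φ D (T ∩ Q) ⊆
      {ω | (∀ i, (Φ ω ∩ gridCell (h / 2) (m i)).encard ≠ 0)
        ∧ (Φ ω ∩ (DQ \ C)).encard = 0} := by
    rintro ω ⟨v, ⟨hvT, hvQ⟩, hvΦ, hvD⟩
    refine ⟨fun i => ?_, ?_⟩
    · rw [Set.encard_ne_zero]
      exact ⟨v i, hvΦ i, hvQ i trivial⟩
    · rw [Set.encard_eq_zero, Set.eq_empty_iff_forall_notMem]
      rintro z ⟨hzΦ, hzD, -⟩
      exact hvD z hzΦ (hDQsub v hvQ hzD)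
  have hprob := hΦ.prob_hit_void_le hl (A := fun i => gridCell (h / 2) (m i)) (D := DQ \ C)
    hcell hcellfin hdisj (hDQopen.measurableSet.diff hCm)
    (measure_ne_top_of_subset Set.sdiff_subset hDQfin)
    (fun i => Set.disjoint_left.2 fun z hz hzi => hz.2 (Set.mem_iUnion.2 ⟨i, hzi⟩))
  refine (measure_mono hsub).trans (hprob.trans ?_)
  have hvolQ : volume Q = ∏ i, volume (gridCell (h / 2) (m i)) := volume_pi_pi _
  have hCfin : volume C ≠ ⊤ := by
    refine ((measure_iUnion_le _).trans_lt ?_).ne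
    rw [tsum_fintype]
    exact ENNReal.sum_lt_top.2 fun i _ => (hcellfin i).lt_top
  have hCvol : volume.real C ≤ n * (Real.pi * h ^ 2) := by
    refine (measureReal_iUnion_fintype_le _).trans ?_
    have : ∀ i ∈ (Finset.univ : Finset (Fin n)),
        volume.real (gridCell (h / 2) (m i)) ≤ Real.pi * h ^ 2 := fun i _ =>
      ENNReal.toReal_le_of_le_ofReal (by positivity) (volume_gridCell_le hh (m i))
    refine (Finset.sum_le_card_nsmul _ _ _ this).trans ?_
    simp
  have hconst : ∫⁻ v in Q, ENNReal.ofReal l ^ n *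
      ENNReal.ofReal (Real.exp (-(l * volume.real (DQ)))) ≤
      ∫⁻ v in Q, ENNReal.ofReal l ^ n *
        ENNReal.ofReal (Real.exp (-(l * volume.real (Prod.mk v ⁻¹' erode h D)))) := by
    refine setLIntegral_mono' (MeasurableSet.univ_pi hcell) fun v hv => ?_
    gcongr
    exact Set.subset_biUnion_of_mem (u := fun v => Prod.mk v ⁻¹' erode h D) hv
  rw [Finset.prod_mul_distrib, Finset.prod_const, Finset.card_univ, Fintype.card_fin, ← hvolQ]
  refine le_trans ?_ (mul_le_mul_right hconst _)
  rw [setLIntegral_const]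
  have hdiff : volume.real DQ - n * (Real.pi * h ^ 2) ≤ volume.real (DQ \ C) := by
    have := le_measureReal_sdiff (μ := volume) (s₁ := DQ) (s₂ := C) hCfin
    linarith
  have hexp : ENNReal.ofReal (Real.exp (-(l * volume.real (DQ \ C)))) ≤
      ENNReal.ofReal (Real.exp (l * (n * (Real.pi * h ^ 2)))) *
        ENNReal.ofReal (Real.exp (-(l * volume.real DQ))) := by
    rw [← ENNReal.ofReal_mul (Real.exp_pos _).le, ← Real.exp_add]
    apply ENNReal.ofReal_le_ofReal
    apply Real.exp_le_exp.2
    nlinarith [mul_le_mul_of_nonneg_left hdiff hl]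
  calc _ ≤ ENNReal.ofReal l ^ n * volume Q * _ := mul_le_mul_right hexp _
    _ = _ := by ring

lemma iUnion_pi_gridCell (s : ℝ) (n : ℕ) :
    ⋃ m : Fin n → Fin 2 → ℤ, (Set.univ.pi fun i => gridCell s (m i)) = Set.univ := by
  refine Set.eq_univ_of_forall fun v => Set.mem_iUnion.2 ⟨fun i a => ⌊v i a / s⌋, ?_⟩
  intro i _ a
  rfl

lemma prob_patternEvent_le_of_separated [IsProbabilityMeasure P] (hΦ : IsPoissonProcess P l Φ)
    (hl : 0 ≤ l) {n : ℕ} {D : Set ((Fin n → Plane) × Plane)}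
    (hfin : ∀ v, volume (Prod.mk v ⁻¹' D) ≠ ⊤) {T : Set (Fin n → Plane)} {h : ℝ} (hh : 0 < h)
    (hsep : ∀ v ∈ T, ∀ i j, i ≠ j → h < dist (v i) (v j)) :
    P (patternEvent Φ D T)
      ≤ ENNReal.ofReal (Real.exp (l * (n * (Real.pi * h ^ 2)))) *
        ∫⁻ v in Metric.cthickening h T, ENNReal.ofReal l ^ n *
            ENNReal.ofReal (Real.exp (-(l * volume.real (Prod.mk v ⁻¹' erode h D)))) := by
  have hU := iUnion_pi_gridCell (h / 2) n
  have hsub : patternEvent Φ D T ⊆ ⋃ m : Fin n → Fin 2 → ℤ,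
      patternEvent Φ D (T ∩ Set.univ.pi fun i => gridCell (h / 2) (m i)) := by
    rintro ω ⟨v, hv, h1⟩
    obtain ⟨m, hm⟩ := Set.mem_iUnion.1 (hU ▸ Set.mem_univ v)
    exact Set.mem_iUnion.2 ⟨m, v, ⟨hv, hm⟩, h1⟩
  refine (measure_mono hsub).trans ((measure_iUnion_le _).trans
    ((ENNReal.tsum_le_tsum fun m => prob_patternEvent_cell_le hΦ hl hfin hh hsep m).trans ?_))
  rw [ENNReal.tsum_mul_left, ← lintegral_iUnion, ← Set.iUnion_inter, hU, Set.univ_inter]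
  · exact fun m => (MeasurableSet.univ_pi fun i => measurableSet_gridCell _ _).inter
      Metric.isClosed_cthickening.measurableSet
  · intro m m' hmm
    rw [Function.onFun, Set.disjoint_left]
    rintro v ⟨hv, -⟩ ⟨hv', -⟩
    exact hmm (funext fun i => funext fun a => (hv i trivial a).symm.trans (hv' i trivial a))

lemma prob_patternEvent_le_of_bounded [IsProbabilityMeasure P] (hΦ : IsPoissonProcess P l Φ)
    (hl : 0 ≤ l) {n : ℕ} {D : Set ((Fin n → Plane) × Plane)} (hD : IsOpen D)
    (hfin : ∀ v, volume (Prod.mk v ⁻¹' D) ≠ ⊤) {T : Set (Fin n → Plane)} (hT : IsClosed T)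
    (hTb : Bornology.IsBounded T) {δ : ℝ} (hδ : 0 < δ)
    (hsep : ∀ v ∈ T, ∀ i j, i ≠ j → δ ≤ dist (v i) (v j)) :
    P (patternEvent Φ D T)
      ≤ ∫⁻ v in T, ENNReal.ofReal l ^ n *
            ENNReal.ofReal (Real.exp (-(l * volume.real (Prod.mk v ⁻¹' D)))) := by
  let h : ℕ → ℝ := fun k => 1 / ((k : ℝ) + 1)
  have hpos : ∀ k, 0 < h k := fun k => by positivity
  have hlim : Tendsto h atTop (𝓝 0) := tendsto_one_div_add_atTop_nhds_zero_nat
  have hanti : Antitone h := fun i j hij => by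
    simp only [h]; gcongr
  let g : ℕ → (Fin n → Plane) → ENNReal := fun k v => ENNReal.ofReal l ^ n *
    ENNReal.ofReal (Real.exp (-(l * volume.real (Prod.mk v ⁻¹' erode (h k) D))))
  let f : ℕ → (Fin n → Plane) → ENNReal := fun k =>
    (Metric.cthickening (h k) T).indicator (g k)
  let F : (Fin n → Plane) → ENNReal := T.indicator fun v => ENNReal.ofReal l ^ n *
    ENNReal.ofReal (Real.exp (-(l * volume.real (Prod.mk v ⁻¹' D))))
  have hgm : ∀ k, Measurable (g k) := by
    intro k
    have : Measurable fun v => volume (Prod.mk v ⁻¹' erode (h k) D) :=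
      measurable_measure_prodMk_left (isOpen_erode _ _).measurableSet
    have h2 : Measurable fun v => volume.real (Prod.mk v ⁻¹' erode (h k) D) := this.ennreal_toReal
    fun_prop
  have herode : ∀ k, erode (h k) D ⊆ D := fun k => by
    conv_rhs => rw [← iUnion_erode hD]
    exact Set.subset_iUnion (fun k : ℕ => erode (1 / ((k : ℝ) + 1)) D) k
  have hefin : ∀ k v, volume (Prod.mk v ⁻¹' erode (h k) D) ≠ ⊤ := fun k v =>
    measure_ne_top_of_subset (Set.preimage_mono (herode k)) (hfin v)
  have hganti : ∀ v, Antitone fun k => g k v := by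
    intro v i j hij
    simp only [g]
    have : volume.real (Prod.mk v ⁻¹' erode (h i) D)
        ≤ volume.real (Prod.mk v ⁻¹' erode (h j) D) :=
      measureReal_mono (Set.preimage_mono (erode_anti (hanti hij) D)) (hefin j v)
    gcongr
  have hgle : ∀ k v, g k v ≤ ENNReal.ofReal l ^ n := by
    intro k v
    refine mul_le_of_le_one_right' ?_
    rw [← ENNReal.ofReal_one]
    apply ENNReal.ofReal_le_ofReal
    rw [Real.exp_le_one_iff, neg_nonpos]
    exact mul_nonneg hl measureReal_nonneg
  have hflim : ∀ v, Tendsto (fun k => f k v) atTop (𝓝 (F v)) := by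
    intro v
    by_cases hv : v ∈ T
    · have h1 : ∀ k, f k v = g k v := fun k =>
        Set.indicator_of_mem (Metric.self_subset_cthickening T hv) _
      simp only [h1, F, Set.indicator_of_mem hv, g]
      refine ENNReal.Tendsto.const_mul (ENNReal.tendsto_ofReal ?_) (Or.inr (by simp))
      · refine (Real.continuous_exp.tendsto _).comp (Tendsto.neg (Tendsto.const_mul l ?_))
        have hU : ⋃ k, (Prod.mk v ⁻¹' erode (h k) D) = Prod.mk v ⁻¹' D := by
          rw [← Set.preimage_iUnion, iUnion_erode hD]
        have hmono : Monotone fun k => Prod.mk v ⁻¹' erode (h k) D := fun i j hij =>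
          Set.preimage_mono (erode_anti (hanti hij) D)
        have h2 := tendsto_measure_iUnion_atTop (μ := volume) hmono
        rw [hU] at h2
        exact (ENNReal.tendsto_toReal (hfin v)).comp h2
    · have h1 : F v = 0 := Set.indicator_of_notMem hv _
      rw [h1]
      have hpos' : 0 < Metric.infEDist v T := by
        rw [pos_iff_ne_zero]
        exact fun h0 => hv ((Metric.mem_iff_infEDist_zero_of_closed hT).2 h0)
      have hl' : Tendsto (fun k => ENNReal.ofReal (h k)) atTop (𝓝 0) := by
        simpa using ENNReal.tendsto_ofReal hlim
      refine tendsto_const_nhds.congr' ?_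
      filter_upwards [hl'.eventually (gt_mem_nhds hpos')] with k hk
      have hm : v ∉ Metric.cthickening (h k) T := not_le.2 hk
      exact (Set.indicator_of_notMem hm (g k)).symm
  have hfanti : ∀ v, Antitone fun k => f k v := by
    intro v i j hij
    refine (Set.indicator_le_indicator_of_subset
      (Metric.cthickening_mono (hanti hij) T) (fun _ => zero_le) v).trans ?_
    exact Set.indicator_le_indicator (hganti v hij)
  have hf0 : ∫⁻ v, f 0 v ≠ ⊤ := by
    have : ∫⁻ v, f 0 v ≤ ∫⁻ v in Metric.cthickening (h 0) T, ENNReal.ofReal l ^ n := by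
      simp only [f]
      rw [lintegral_indicator Metric.isClosed_cthickening.measurableSet]
      exact lintegral_mono fun v => hgle 0 v
    refine (this.trans_lt ?_).ne
    rw [setLIntegral_const]
    exact ENNReal.mul_lt_top (by simp) hTb.cthickening.measure_lt_top
  have hint := lintegral_tendsto_of_tendsto_of_antitone (μ := volume) (f := f) (F := F)
    (fun k => ((hgm k).indicator Metric.isClosed_cthickening.measurableSet).aemeasurable)
    (ae_of_all _ hfanti) hf0 (ae_of_all _ hflim)
  have hexp : Tendsto (fun k => ENNReal.ofReal (Real.exp (l * (n * (Real.pi * h k ^ 2)))))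
      atTop (𝓝 1) := by
    have h1 : Tendsto (fun k => Real.exp (l * (n * (Real.pi * h k ^ 2)))) atTop
        (𝓝 (Real.exp (l * (n * (Real.pi * 0 ^ 2))))) :=
      (Real.continuous_exp.tendsto _).comp
        (((hlim.pow 2).const_mul _).const_mul _ |>.const_mul _)
    simpa using ENNReal.tendsto_ofReal h1
  have hprod := ENNReal.Tendsto.mul hexp (Or.inl one_ne_zero) hint (Or.inr ENNReal.one_ne_top)
  rw [one_mul] at hprod
  simp only [F] at hprod
  rw [lintegral_indicator hT.measurableSet] at hprod
  refine ge_of_tendsto hprod ?_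
  filter_upwards [hlim.eventually (gt_mem_nhds hδ)] with k hk
  have := prob_patternEvent_le_of_separated hΦ hl hfin (hpos k)
    (fun v hv i j hij => hk.trans_le (hsep v hv i j hij))
  refine this.trans_eq ?_
  simp only [f]
  rw [lintegral_indicator Metric.isClosed_cthickening.measurableSet]

/-- The probability that a Poisson process contains an injective pattern from the closed set `T`
whose associated open region is void is at most the integral of the intensity of such patterns. -/
lemma prob_patternEvent_le [IsProbabilityMeasure P] (hΦ : IsPoissonProcess P l Φ)
    (hl : 0 ≤ l) {n : ℕ} {D : Set ((Fin n → Plane) × Plane)} (hD : IsOpen D)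
    (hfin : ∀ v, volume (Prod.mk v ⁻¹' D) ≠ ⊤) {T : Set (Fin n → Plane)} (hT : IsClosed T) :
    P (patternEvent Φ D (T ∩ {v | Function.Injective v}))
      ≤ ∫⁻ v in T, ENNReal.ofReal l ^ n *
            ENNReal.ofReal (Real.exp (-(l * volume.real (Prod.mk v ⁻¹' D)))) := by
  let S : ℕ → Set (Fin n → Plane) := fun k => T ∩ (Metric.closedBall 0 k ∩
    {v | ∀ i j, i ≠ j → 1 / ((k : ℝ) + 1) ≤ dist (v i) (v j)})
  have hSclosed : ∀ k, IsClosed (S k) := by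
    intro k
    refine hT.inter (Metric.isClosed_closedBall.inter ?_)
    simp only [Set.ofPred_forall]
    refine isClosed_iInter fun i => isClosed_iInter fun j => isClosed_iInter fun _ => ?_
    exact isClosed_le continuous_const (by fun_prop)
  have hSmono : Monotone S := by
    intro a b hab v ⟨hvT, hvb, hvs⟩
    refine ⟨hvT, Metric.closedBall_subset_closedBall (by exact_mod_cast hab) hvb,
      fun i j hij => le_trans ?_ (hvs i j hij)⟩
    gcongr
  have hcover : T ∩ {v | Function.Injective v} ⊆ ⋃ k, S k := by
    rintro v ⟨hvT, hvi⟩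
    have h1 : ∀ᶠ k : ℕ in atTop, ‖v‖ ≤ k := by
      filter_upwards [eventually_ge_atTop ⌈‖v‖⌉₊] with k hk
      exact (Nat.le_ceil _).trans (by exact_mod_cast hk)
    have h2 : ∀ᶠ k : ℕ in atTop, ∀ i j, i ≠ j → 1 / ((k : ℝ) + 1) ≤ dist (v i) (v j) := by
      rw [eventually_all]; intro i
      rw [eventually_all]; intro j
      by_cases hij : i = j
      · exact Eventually.of_forall fun _ h => absurd hij h
      · have : 0 < dist (v i) (v j) := dist_pos.2 fun e => hij (hvi e)
        filter_upwards [(tendsto_one_div_add_atTop_nhds_zero_nat (𝕜 := ℝ)).eventually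
          (gt_mem_nhds this)] with k hk _
        exact hk.le
    obtain ⟨k, hk1, hk2⟩ := (h1.and h2).exists
    exact Set.mem_iUnion.2 ⟨k, hvT, by simpa using hk1, hk2⟩
  have hsub : patternEvent Φ D (T ∩ {v | Function.Injective v})
      ⊆ ⋃ k, patternEvent Φ D (S k) := by
    rintro ω ⟨v, hv, h1⟩
    obtain ⟨k, hk⟩ := Set.mem_iUnion.1 (hcover hv)
    exact Set.mem_iUnion.2 ⟨k, v, hk, h1⟩
  refine (measure_mono hsub).trans ?_
  rw [Directed.measure_iUnion (Monotone.directed_le fun a b hab => patternEvent_mono D (hSmono hab))]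
  refine iSup_le fun k => ?_
  refine (prob_patternEvent_le_of_bounded hΦ hl hD hfin (hSclosed k)
    (Metric.isBounded_closedBall.subset fun v hv => hv.2.1)
    (δ := 1 / ((k : ℝ) + 1)) (by positivity) fun v hv => hv.2.2).trans ?_
  exact lintegral_mono_set fun v hv => hv.1

end Pattern

/-! ### Cones, sectors and polar coordinates -/

section Polar

variable {θ : ℝ}

lemma abs_sin_le_iff (hθ : 0 < θ) (hθ' : θ < Real.pi / 2) {φ : ℝ} (hφ : |φ| < Real.pi) :
    |Real.sin φ| ≤ Real.tan θ * Real.cos φ ↔ |φ| ≤ θ := by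
  have hc : 0 < Real.cos θ := Real.cos_pos_of_mem_Ioo ⟨by linarith, hθ'⟩
  have h1 : |Real.sin φ| = Real.sin |φ| := by
    rw [Real.abs_sin_eq_sin_abs_of_abs_le_pi hφ.le]
  have h2 : Real.tan θ * Real.cos φ - |Real.sin φ| = Real.sin (θ - |φ|) / Real.cos θ := by
    rw [Real.sin_sub, h1, Real.tan_eq_sin_div_cos, Real.cos_abs]; field_simp
  rw [← sub_nonneg, h2, le_div_iff₀ hc, zero_mul]
  constructor
  · intro h
    by_contra hlt
    have := Real.sin_neg_of_neg_of_neg_pi_lt (x := θ - |φ|) (by linarith) (by linarith)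
    linarith
  · intro h
    exact Real.sin_nonneg_of_nonneg_of_le_pi (by linarith) (by linarith [abs_nonneg φ])

lemma abs_sin_lt_iff (hθ : 0 < θ) (hθ' : θ < Real.pi / 2) {φ : ℝ} (hφ : |φ| < Real.pi) :
    |Real.sin φ| < Real.tan θ * Real.cos φ ↔ |φ| < θ := by
  have hc : 0 < Real.cos θ := Real.cos_pos_of_mem_Ioo ⟨by linarith, hθ'⟩
  have h1 : |Real.sin φ| = Real.sin |φ| := by
    rw [Real.abs_sin_eq_sin_abs_of_abs_le_pi hφ.le]
  have h2 : Real.tan θ * Real.cos φ - |Real.sin φ| = Real.sin (θ - |φ|) / Real.cos θ := by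
    rw [Real.sin_sub, h1, Real.tan_eq_sin_div_cos, Real.cos_abs]; field_simp
  rw [← sub_pos, h2, div_pos_iff_of_pos_right hc]
  constructor
  · intro h
    by_contra hlt
    have := Real.sin_nonpos_of_nonpos_of_neg_pi_le (x := θ - |φ|) (by linarith) (by linarith)
    linarith
  · intro h
    exact Real.sin_pos_of_pos_of_lt_pi (by linarith) (by linarith [abs_nonneg φ])

lemma tan_pos_of_lt (hθ : 0 < θ) (hθ' : θ < Real.pi / 2) : 0 < Real.tan θ :=
  Real.tan_pos_of_pos_of_lt_pi_div_two hθ hθ'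

lemma mem_cone_iff (hθ : 0 < θ) (hθ' : θ < Real.pi / 2) (v w : Plane) :
    w ∈ cone θ v ↔ 0 < w 0 - v 0 ∧ |w 1 - v 1| ≤ Real.tan θ * (w 0 - v 0) := by
  constructor
  · rintro ⟨r, φ, hr, hφ, rfl⟩
    have h := (abs_sin_le_iff hθ hθ' (by linarith : |φ| < Real.pi)).2 hφ
    have hc : 0 < Real.cos φ := Real.cos_pos_of_mem_Ioo (abs_lt.1 (hφ.trans_lt hθ'))
    simp only [PiLp.add_apply, Matrix.cons_val_zero, add_sub_cancel_left, Matrix.cons_val_one]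
    refine ⟨by positivity, ?_⟩
    rw [abs_mul, abs_of_pos hr]
    nlinarith
  · rintro ⟨hx, hy⟩
    set x := w 0 - v 0
    set y := w 1 - v 1
    have hs : 0 < √(1 + (y / x) ^ 2) := Real.sqrt_pos.2 (by positivity)
    refine ⟨x * √(1 + (y / x) ^ 2), Real.arctan (y / x), by positivity, ?_, ?_⟩
    · rw [← Real.arctan_tan (x := θ) (by linarith) hθ', abs_le]
      have hy' := abs_le.1 hy
      rw [← Real.arctan_neg]
      constructor
      · apply Real.arctan_mono
        rw [le_div_iff₀ hx]; linarith
      · apply Real.arctan_mono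
        rw [div_le_iff₀ hx]; linarith
    · rw [Real.cos_arctan, Real.sin_arctan]
      ext i
      fin_cases i
      · simp only [Fin.zero_eta, PiLp.add_apply, Matrix.cons_val_zero]
        rw [mul_assoc, mul_one_div_cancel hs.ne']; simp [x]
      · simp only [Fin.mk_one, PiLp.add_apply, Matrix.cons_val_one]
        have : x * √(1 + (y / x) ^ 2) * (y / x / √(1 + (y / x) ^ 2)) = y := by
          field_simp
        simp only [Matrix.cons_val_fin_one, this]; simp [y]

lemma lintegral_plane_eq_prod (g : Plane → ENNReal) :
    ∫⁻ w, g w = ∫⁻ p : ℝ × ℝ, g !₂[p.1, p.2] := by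
  have h1 := (PiLp.volume_preserving_toLp (Fin 2)).comp
    (volume_preserving_finTwoArrow ℝ).symm
  have h2 := h1.lintegral_comp_emb (((MeasurableEquiv.toLp 2 (Fin 2 → ℝ)).measurableEmbedding).comp
    (MeasurableEquiv.finTwoArrow (α := ℝ)).symm.measurableEmbedding) g
  exact h2.symm

lemma lintegral_plane_polar {g : Plane → ENNReal} (hg : Measurable g) :
    ∫⁻ w, g w = ∫⁻ r in Set.Ioi (0 : ℝ), ∫⁻ φ in Set.Ioo (-Real.pi) Real.pi,
      ENNReal.ofReal r * g !₂[r * Real.cos φ, r * Real.sin φ] := by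
  rw [lintegral_plane_eq_prod, ← lintegral_comp_polarCoord_symm, polarCoord_target,
    Measure.volume_eq_prod, ← Measure.prod_restrict, lintegral_prod]
  · rfl
  · apply Measurable.aemeasurable
    simp only [polarCoord_symm_apply, smul_eq_mul]
    have hm : Measurable fun p : ℝ × ℝ => (!₂[p.1 * Real.cos p.2, p.1 * Real.sin p.2] : Plane) := by
      refine (MeasurableEquiv.toLp 2 (Fin 2 → ℝ)).measurable.comp ?_
      refine measurable_pi_lambda _ fun i => ?_
      fin_cases i <;> simp <;> fun_prop
    exact (by fun_prop : Measurable fun p : ℝ × ℝ => ENNReal.ofReal p.1).mul (hg.comp hm)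

/-- The points of the open cone with apex `a` that are closer to `a` than `b`. -/
def openSector (θ : ℝ) (a b : Plane) : Set Plane :=
  {z | |z 1 - a 1| < Real.tan θ * (z 0 - a 0) ∧ dist z a < dist b a}

lemma norm_polar {r : ℝ} (hr : 0 ≤ r) (φ : ℝ) :
    ‖(!₂[r * Real.cos φ, r * Real.sin φ] : Plane)‖ = r := by
  rw [EuclideanSpace.norm_eq, Fin.sum_univ_two]
  simp only [Matrix.cons_val_zero, Matrix.cons_val_one, Real.norm_eq_abs, sq_abs]
  rw [show (r * Real.cos φ) ^ 2 + (r * Real.sin φ) ^ 2 = r ^ 2 by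
    nlinarith [Real.sin_sq_add_cos_sq φ], Real.sqrt_sq hr]

lemma isOpen_sector_prod {α : Type*} [TopologicalSpace α] {a b : α → Plane} (ha : Continuous a)
    (hb : Continuous b) (θ : ℝ) : IsOpen {p : α × Plane | p.2 ∈ openSector θ (a p.1) (b p.1)} := by
  have ha0 : Continuous fun p : α × Plane => a p.1 := by fun_prop
  have hb0 : Continuous fun p : α × Plane => b p.1 := by fun_prop
  have h1 : IsOpen {p : α × Plane | |p.2 1 - a p.1 1| < Real.tan θ * (p.2 0 - a p.1 0)} :=
    isOpen_lt (by fun_prop) (by fun_prop)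
  have h2 : IsOpen {p : α × Plane | dist p.2 (a p.1) < dist (b p.1) (a p.1)} :=
    isOpen_lt (by fun_prop) (by fun_prop)
  exact h1.inter h2

lemma isOpen_openSector (θ : ℝ) (a b : Plane) : IsOpen (openSector θ a b) :=
  (isOpen_sector_prod (α := Unit) (a := fun _ => a) (b := fun _ => b)
    continuous_const continuous_const θ).preimage (f := fun z => ((), z)) (by fun_prop)

lemma lintegral_Ioo_id (R : ℝ) (hR : 0 ≤ R) :
    ∫⁻ r in Set.Ioo 0 R, ENNReal.ofReal r = ENNReal.ofReal (R ^ 2 / 2) := by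
  rw [← ofReal_integral_eq_lintegral_ofReal]
  · rw [← integral_Ioc_eq_integral_Ioo, ← intervalIntegral.integral_of_le hR, integral_id]; simp
  · exact (continuous_id.integrableOn_Icc (a := 0) (b := R)).mono_set Set.Ioo_subset_Icc_self
  · filter_upwards [ae_restrict_mem measurableSet_Ioo] with r hr using hr.1.le

lemma volume_openSector (hθ : 0 < θ) (hθ' : θ < Real.pi / 2) (a b : Plane) :
    volume (openSector θ a b) = ENNReal.ofReal (θ * dist b a ^ 2) := by
  set R := dist b a with hR
  have hR0 : 0 ≤ R := dist_nonneg
  have htr : openSector θ a b = (fun z => z - a) ⁻¹' {w | |w 1| < Real.tan θ * w 0 ∧ ‖w‖ < R} := by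
    ext z; simp [openSector, dist_eq_norm, R]
  set S : Set Plane := {w | |w 1| < Real.tan θ * w 0 ∧ ‖w‖ < R} with hS
  have hSm : MeasurableSet S := by
    have h1 : IsOpen {w : Plane | |w 1| < Real.tan θ * w 0} :=
      isOpen_lt (by fun_prop) (by fun_prop)
    have h2 : IsOpen {w : Plane | ‖w‖ < R} := isOpen_lt (by fun_prop) (by fun_prop)
    exact (h1.inter h2).measurableSet
  have htr' : volume ((fun z => z - a) ⁻¹' S) = volume S := by
    simp_rw [sub_eq_add_neg]; exact measure_preimage_add_right _ _ _
  rw [htr, htr', ← lintegral_indicator_one hSm,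
    lintegral_plane_polar (measurable_one.indicator hSm)]
  have hinner : ∀ r ∈ Set.Ioi (0 : ℝ), ∫⁻ φ in Set.Ioo (-Real.pi) Real.pi,
      ENNReal.ofReal r * S.indicator 1 !₂[r * Real.cos φ, r * Real.sin φ]
      = (Set.Iio R).indicator (fun r => ENNReal.ofReal r * ENNReal.ofReal (2 * θ)) r := by
    intro r hr
    rw [Set.mem_Ioi] at hr
    have h1 : ∀ φ ∈ Set.Ioo (-Real.pi) Real.pi,
        ENNReal.ofReal r * S.indicator 1 !₂[r * Real.cos φ, r * Real.sin φ]
        = (Set.Ioo (-θ) θ).indicator (fun _ => if r < R then ENNReal.ofReal r else 0) φ := by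
      intro φ hφ
      have hmem : (!₂[r * Real.cos φ, r * Real.sin φ] : Plane) ∈ S ↔ |φ| < θ ∧ r < R := by
        simp only [hS, Set.mem_ofPred_eq, norm_polar hr.le]
        rw [← abs_sin_lt_iff hθ hθ' (abs_lt.2 hφ)]
        simp only [Matrix.cons_val_zero, Matrix.cons_val_one, abs_mul, abs_of_pos hr]
        rw [mul_left_comm, mul_lt_mul_iff_right₀ hr]
      by_cases h2 : |φ| < θ
      · rw [Set.indicator_of_mem (show φ ∈ Set.Ioo (-θ) θ from abs_lt.1 h2)]
        by_cases h3 : r < R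
        · rw [Set.indicator_of_mem (hmem.2 ⟨h2, h3⟩)]; simp [h3]
        · rw [Set.indicator_of_notMem (fun h => h3 (hmem.1 h).2)]; simp [h3]
      · rw [Set.indicator_of_notMem (show φ ∉ Set.Ioo (-θ) θ from fun h => h2 (abs_lt.2 h)),
          Set.indicator_of_notMem (fun h => h2 (hmem.1 h).1), mul_zero]
    rw [setLIntegral_congr_fun measurableSet_Ioo h1, lintegral_indicator measurableSet_Ioo,
      setLIntegral_const, Measure.restrict_apply measurableSet_Ioo,
      Set.inter_eq_left.2 (Set.Ioo_subset_Ioo (by linarith) (by linarith)), Real.volume_Ioo]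
    by_cases h3 : r < R
    · rw [Set.indicator_of_mem (show r ∈ Set.Iio R from h3), if_pos h3]; congr 2; ring
    · rw [Set.indicator_of_notMem (show r ∉ Set.Iio R from h3), if_neg h3, zero_mul]
  rw [setLIntegral_congr_fun measurableSet_Ioi hinner, setLIntegral_indicator measurableSet_Iio,
    Set.Iio_inter_Ioi, lintegral_mul_const _ (by fun_prop), lintegral_Ioo_id R hR0,
    ← ENNReal.ofReal_mul (by positivity)]
  congr 1; ring

end Polar

section Path

/-! ### Paths and the law of the waypoints -/

/-- The predecessor of the `i`-th point of the path `0, v 0, v 1, …`. -/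
def pred {n : ℕ} (v : Fin n → Plane) (i : Fin n) : Plane :=
  if h : (i : ℕ) = 0 then 0 else v ⟨i - 1, by omega⟩

/-- The `i`-th increment of the path `0, v 0, v 1, …`. -/
def step {n : ℕ} (v : Fin n → Plane) (i : Fin n) : Plane := v i - pred v i

lemma continuous_pred {n : ℕ} (i : Fin n) : Continuous fun v : Fin n → Plane => pred v i := by
  unfold pred
  split_ifs <;> fun_prop

lemma continuous_step {n : ℕ} (i : Fin n) : Continuous fun v : Fin n → Plane => step v i :=
  (continuous_apply i).sub (continuous_pred i)

lemma pred_snoc_castSucc {n : ℕ} (v : Fin n → Plane) (w : Plane) (i : Fin n) :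
    pred (Fin.snoc v w : Fin (n + 1) → Plane) i.castSucc = pred v i := by
  unfold pred
  by_cases h : (i : ℕ) = 0
  · simp [h]
  · rw [dif_neg (by simpa using h), dif_neg h]
    exact Fin.snoc_castSucc (α := fun _ => Plane) w v ⟨i - 1, by omega⟩

lemma pred_snoc_last {n : ℕ} (v : Fin n → Plane) (w w' : Plane) :
    pred (Fin.snoc v w : Fin (n + 1) → Plane) (Fin.last n)
      = pred (Fin.snoc v w' : Fin (n + 1) → Plane) (Fin.last n) := by
  unfold pred
  by_cases h : n = 0
  · subst h; simp
  · rw [dif_neg (by simpa using h), dif_neg (by simpa using h)]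
    exact (Fin.snoc_castSucc (α := fun _ => Plane) w v ⟨n - 1, by omega⟩).trans
      (Fin.snoc_castSucc (α := fun _ => Plane) w' v ⟨n - 1, by omega⟩).symm

lemma sum_step {n : ℕ} (v : Fin (n + 1) → Plane) : ∑ i, step v i = v (Fin.last n) := by
  have key : ∀ m (hm : m < n + 1), ∑ i : Fin (m + 1), step v ⟨i, by omega⟩ = v ⟨m, hm⟩ := by
    intro m
    induction m with
    | zero => intro hm; simp [step, pred]
    | succ m ih =>
      intro hm
      rw [Fin.sum_univ_castSucc]
      have h1 := ih (by omega)
      simp only [Fin.val_castSucc, Fin.val_last]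
      rw [h1]
      simp [step, pred]
  exact key n (by omega)

/-- The integral of a product of functions of the increments. -/
lemma lintegral_prod_step {n : ℕ} {g : Fin n → Plane → ENNReal} (hg : ∀ i, Measurable (g i)) :
    ∫⁻ v : Fin n → Plane, ∏ i, g i (step v i) = ∏ i, ∫⁻ w, g i w := by
  induction n with
  | zero => simp [volume_pi]
  | succ n ih =>
    have hmp := (volume_preserving_piFinSuccAbove (fun _ : Fin (n + 1) => Plane) (Fin.last n)).symm
    have hmeas : Measurable fun v : Fin (n + 1) → Plane => ∏ i, g i (step v i) :=
      Finset.measurable_fun_prod _ fun i _ => (hg i).comp (continuous_step i).measurable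
    rw [← hmp.lintegral_comp hmeas, Measure.volume_eq_prod,
      lintegral_prod_symm _ (by exact (hmeas.comp hmp.measurable).aemeasurable)]
    have hsymm : ∀ (w : Plane) (v : Fin n → Plane),
        (MeasurableEquiv.piFinSuccAbove (fun _ : Fin (n + 1) => Plane) (Fin.last n)).symm (w, v)
          = Fin.snoc v w := by
      intro w v
      simp [MeasurableEquiv.piFinSuccAbove, Fin.insertNthEquiv, Fin.insertNth_last']
    simp only [hsymm]
    rw [Fin.prod_univ_castSucc, ← ih fun i => hg i.castSucc, ← lintegral_mul_const]
    · refine lintegral_congr fun v => ?_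
      have h1 : ∀ w, ∏ i, g i (step (Fin.snoc v w : Fin (n + 1) → Plane) i)
          = (∏ i : Fin n, g i.castSucc (step v i)) *
            g (Fin.last n) (w - pred (Fin.snoc v 0 : Fin (n + 1) → Plane) (Fin.last n)) := by
        intro w
        rw [Fin.prod_univ_castSucc]
        congr 1
        · refine Finset.prod_congr rfl fun i _ => ?_
          rw [step, pred_snoc_castSucc, Fin.snoc_castSucc, step]
        · rw [step, pred_snoc_last v w 0, Fin.snoc_last]
      simp only [h1]
      have h2 : Measurable fun w =>
          g (Fin.last n) (w - pred (Fin.snoc v 0 : Fin (n + 1) → Plane) (Fin.last n)) :=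
        (hg _).comp (measurable_id.sub_const _)
      rw [lintegral_const_mul _ h2]
      congr 1
      simp_rw [sub_eq_add_neg]
      exact lintegral_add_right_eq_self (g (Fin.last n)) _
    · exact Finset.measurable_fun_prod _ fun i _ => (hg _).comp (continuous_step i).measurable

/-- The increments that stay in the closed cone. -/
def closedCone (θ : ℝ) : Set Plane := {w | |w 1| ≤ Real.tan θ * w 0}

lemma isClosed_closedCone (θ : ℝ) : IsClosed (closedCone θ) := by
  have : IsClosed {w : Plane | |w 1| ≤ Real.tan θ * w 0} := isClosed_le (by fun_prop) (by fun_prop)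
  exact this

lemma add_mem_closedCone {θ : ℝ} {a b : Plane} (ha : a ∈ closedCone θ) (hb : b ∈ closedCone θ) :
    a + b ∈ closedCone θ := by
  simp only [closedCone, Set.mem_ofPred_eq, PiLp.add_apply] at *
  have := abs_add_le (a 1) (b 1)
  linarith

lemma zero_mem_closedCone (θ : ℝ) : (0 : Plane) ∈ closedCone θ := by
  simp [closedCone]

lemma sub_mem_closedCone_of_step {θ : ℝ} {n : ℕ} {v : Fin n → Plane}
    (hv : ∀ i, step v i ∈ closedCone θ) {a b : Fin n} (hab : a ≤ b) :
    v b - v a ∈ closedCone θ := by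
  obtain ⟨b, hb⟩ := b
  obtain ⟨a, ha⟩ := a
  simp only [Fin.mk_le_mk] at hab
  induction b, hab using Nat.le_induction with
  | base => simpa using zero_mem_closedCone θ
  | succ b hab ih =>
    have h1 := ih (by omega)
    have h2 := hv ⟨b + 1, hb⟩
    have h3 : step v ⟨b + 1, hb⟩ = v ⟨b + 1, hb⟩ - v ⟨b, by omega⟩ := by simp [step, pred]
    rw [h3] at h2
    have := add_mem_closedCone h2 h1
    simpa using this

variable {θ : ℝ}

lemma tan_le_one (hθ : 0 < θ) (hθ' : θ ≤ Real.pi / 4) : Real.tan θ ≤ 1 := by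
  rw [← Real.tan_pi_div_four]
  exact Real.strictMonoOn_tan.monotoneOn ⟨by linarith, by linarith [Real.pi_pos]⟩
    ⟨by linarith [Real.pi_pos], by linarith [Real.pi_pos]⟩ hθ'

lemma lt_pi_div_two (hθ' : θ ≤ Real.pi / 4) : θ < Real.pi / 2 := by
  linarith [Real.pi_pos]

lemma coord_nonneg_of_mem_closedCone (hθ : 0 < θ) (hθ' : θ ≤ Real.pi / 4) {w : Plane}
    (hw : w ∈ closedCone θ) : 0 ≤ w 0 := by
  have h := tan_pos_of_lt hθ (lt_pi_div_two hθ')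
  have h1 : |w 1| ≤ Real.tan θ * w 0 := hw
  by_contra hneg
  have := abs_nonneg (w 1)
  nlinarith

lemma abs_le_of_mem_closedCone (hθ : 0 < θ) (hθ' : θ ≤ Real.pi / 4) {w : Plane}
    (hw : w ∈ closedCone θ) : |w 1| ≤ w 0 := by
  have h := tan_le_one hθ hθ'
  have h1 : |w 1| ≤ Real.tan θ * w 0 := hw
  have h2 := coord_nonneg_of_mem_closedCone hθ hθ' hw
  nlinarith

/-- Vectors of the closed cone form acute angles, so that adding them increases the norm. -/
lemma norm_le_norm_add (hθ : 0 < θ) (hθ' : θ ≤ Real.pi / 4) {a b : Plane}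
    (ha : a ∈ closedCone θ) (hb : b ∈ closedCone θ) : ‖a‖ ≤ ‖a + b‖ := by
  have ha0 := coord_nonneg_of_mem_closedCone hθ hθ' ha
  have hb0 := coord_nonneg_of_mem_closedCone hθ hθ' hb
  have ha1 := abs_le.1 (abs_le_of_mem_closedCone hθ hθ' ha)
  have hb1 := abs_le.1 (abs_le_of_mem_closedCone hθ hθ' hb)
  rw [EuclideanSpace.norm_eq, EuclideanSpace.norm_eq]
  apply Real.sqrt_le_sqrt
  simp only [Fin.sum_univ_two, Real.norm_eq_abs, sq_abs, PiLp.add_apply]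
  nlinarith [mul_nonneg (sub_nonneg.2 ha1.2) (sub_nonneg.2 hb1.2), sq_nonneg (b 0), sq_nonneg (b 1),
    mul_nonneg (neg_le_iff_add_nonneg.1 ha1.1) (neg_le_iff_add_nonneg.1 hb1.1)]

/-- The pairs of a path and a point in one of the open sectors of the path. -/
def sectorRegion (θ : ℝ) (n : ℕ) : Set ((Fin n → Plane) × Plane) :=
  {p | ∃ i, p.2 ∈ openSector θ (pred p.1 i) (p.1 i)}

lemma isOpen_sectorRegion (θ : ℝ) (n : ℕ) : IsOpen (sectorRegion θ n) := by
  have : sectorRegion θ n = ⋃ i, {p | p.2 ∈ openSector θ (pred p.1 i) (p.1 i)} := by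
    ext p; simp [sectorRegion]
  rw [this]
  exact isOpen_iUnion fun i => isOpen_sector_prod (continuous_pred i) (continuous_apply i) θ

lemma sectorRegion_section (θ : ℝ) {n : ℕ} (v : Fin n → Plane) :
    Prod.mk v ⁻¹' sectorRegion θ n = ⋃ i, openSector θ (pred v i) (v i) := by
  ext z; simp [sectorRegion]

lemma volume_sectorRegion_ne_top (hθ : 0 < θ) (hθ' : θ ≤ Real.pi / 4) {n : ℕ} (v : Fin n → Plane) :
    volume (Prod.mk v ⁻¹' sectorRegion θ n) ≠ ⊤ := by
  rw [sectorRegion_section]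
  refine ((measure_iUnion_le _).trans_lt ?_).ne
  rw [tsum_fintype]
  refine ENNReal.sum_lt_top.2 fun i _ => ?_
  rw [volume_openSector hθ (lt_pi_div_two hθ')]
  exact ENNReal.ofReal_lt_top

lemma disjoint_openSector (hθ : 0 < θ) (hθ' : θ ≤ Real.pi / 4) {n : ℕ} {v : Fin n → Plane}
    (hv : ∀ i, step v i ∈ closedCone θ) {i j : Fin n} (hij : i < j) :
    Disjoint (openSector θ (pred v i) (v i)) (openSector θ (pred v j) (v j)) := by
  rw [Set.disjoint_left]
  rintro z ⟨-, hzi⟩ ⟨hzj, -⟩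
  have hpred : pred v j = v ⟨j - 1, by omega⟩ := by
    rw [pred, dif_neg (by have := Fin.lt_def.1 hij; omega)]
  have h1 : v ⟨j - 1, by omega⟩ - v i ∈ closedCone θ :=
    sub_mem_closedCone_of_step hv (by have := Fin.lt_def.1 hij; rw [Fin.le_def]; simp; omega)
  have h2 : z - pred v j ∈ closedCone θ := by
    simp only [closedCone, Set.mem_ofPred_eq, PiLp.sub_apply]
    exact hzj.le
  rw [hpred] at h2
  have h3 := norm_le_norm_add hθ hθ' (hv i) (add_mem_closedCone h1 h2)
  rw [dist_eq_norm, dist_eq_norm] at hzi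
  have h4 : step v i + (v ⟨j - 1, by omega⟩ - v i + (z - v ⟨j - 1, by omega⟩))
      = z - pred v i := by rw [step]; abel
  rw [h4, step] at h3
  linarith

lemma volume_sectorRegion (hθ : 0 < θ) (hθ' : θ ≤ Real.pi / 4) {n : ℕ} {v : Fin n → Plane}
    (hv : ∀ i, step v i ∈ closedCone θ) :
    volume.real (Prod.mk v ⁻¹' sectorRegion θ n) = ∑ i, θ * ‖step v i‖ ^ 2 := by
  have hdisj : Pairwise (Function.onFun Disjoint fun i => openSector θ (pred v i) (v i)) := by
    intro i j hij
    rcases lt_or_gt_of_ne hij with h | h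
    · exact disjoint_openSector hθ hθ' hv h
    · exact (disjoint_openSector hθ hθ' hv h).symm
  rw [sectorRegion_section, Measure.real,
    measure_iUnion hdisj fun i => (isOpen_openSector _ _ _).measurableSet, tsum_fintype,
    ENNReal.toReal_sum]
  · refine Finset.sum_congr rfl fun i _ => ?_
    rw [volume_openSector hθ (lt_pi_div_two hθ'), ENNReal.toReal_ofReal (by positivity),
      dist_eq_norm, step]
  · intro i _
    rw [volume_openSector hθ (lt_pi_div_two hθ')]
    exact ENNReal.ofReal_ne_top

/-- The density of a step of the navigation. -/
noncomputable def stepDensity (l θ : ℝ) (w : Plane) : ENNReal :=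
  (closedCone θ).indicator (fun w => ENNReal.ofReal (l * Real.exp (-(l * θ * ‖w‖ ^ 2)))) w

lemma measurable_stepDensity (l θ : ℝ) : Measurable (stepDensity l θ) :=
  Measurable.indicator (by fun_prop) (isClosed_closedCone θ).measurableSet

/-- The density of the first `n` waypoints. -/
noncomputable def pathDensity (l θ : ℝ) {n : ℕ} (v : Fin n → Plane) : ENNReal :=
  ∏ i, stepDensity l θ (step v i)

lemma measurable_pathDensity (l θ : ℝ) (n : ℕ) :
    Measurable (pathDensity l θ : (Fin n → Plane) → ENNReal) :=
  Finset.measurable_fun_prod _ fun i _ =>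
    (measurable_stepDensity l θ).comp (continuous_step i).measurable

variable {Ω : Type*} [MeasurableSpace Ω] {P : Measure Ω} {l : ℝ} {Φ : Ω → Set Plane}

lemma step_mem_of_isSuccessor (hθ : 0 < θ) (hθ' : θ ≤ Real.pi / 4) {S : Set Plane} {v w : Plane}
    (h : IsSuccessor θ S v w) : w - v ∈ closedCone θ ∧ 0 < (w - v) 0 := by
  have h1 := (mem_cone_iff hθ (lt_pi_div_two hθ') v w).1 h.1.2
  exact ⟨h1.2, h1.1⟩

lemma prob_path_le [IsProbabilityMeasure P] (hΦ : IsPoissonProcess P l Φ) (hl : 0 ≤ l)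
    (hθ : 0 < θ) (hθ' : θ ≤ Real.pi / 4) {n : ℕ} {T : Set (Fin n → Plane)} (hT : IsClosed T) :
    P {ω | ∃ v ∈ T, ∀ i, IsSuccessor θ (Φ ω) (pred v i) (v i)}
      ≤ ∫⁻ v in T, pathDensity l θ v := by
  set K : Set (Fin n → Plane) := {v | ∀ i, step v i ∈ closedCone θ} with hK
  have hKc : IsClosed K := by
    simp only [hK, Set.ofPred_forall]
    exact isClosed_iInter fun i => (isClosed_closedCone θ).preimage (continuous_step i)
  have hinj : ∀ v ∈ K, (∀ i, 0 < step v i 0) → Function.Injective v := by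
    intro v hv hpos
    have key : ∀ i j : Fin n, i < j → v i ≠ v j := by
      intro i j hij heq
      have hpred : pred v j = v ⟨j - 1, by omega⟩ := by
        rw [pred, dif_neg (by have := Fin.lt_def.1 hij; omega)]
      have h1 := coord_nonneg_of_mem_closedCone hθ hθ'
        (sub_mem_closedCone_of_step hv (a := i) (b := ⟨j - 1, by omega⟩)
        (by have := Fin.lt_def.1 hij; rw [Fin.le_def]; simp; omega))
      have h2 := hpos j
      rw [step, hpred, ← heq] at h2
      simp only [PiLp.sub_apply] at h1 h2
      linarith
    intro i j hij
    rcases lt_trichotomy i j with h | h | h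
    · exact absurd hij (key i j h)
    · exact h
    · exact absurd hij.symm (key j i h)
  have hsub : {ω | ∃ v ∈ T, ∀ i, IsSuccessor θ (Φ ω) (pred v i) (v i)} ⊆
      patternEvent Φ (sectorRegion θ n) ((T ∩ K) ∩ {v | Function.Injective v}) := by
    rintro ω ⟨v, hvT, hv⟩
    have hvK : v ∈ K := fun i => (step_mem_of_isSuccessor hθ hθ' (hv i)).1
    refine ⟨v, ⟨⟨hvT, hvK⟩, hinj v hvK fun i =>
      (step_mem_of_isSuccessor hθ hθ' (hv i)).2⟩, fun i => (hv i).1.1, ?_⟩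
    rintro z hz ⟨i, hz1, hz2⟩
    refine absurd ((hv i).2 z ⟨hz, ?_⟩) (not_le.2 hz2)
    rw [mem_cone_iff hθ (lt_pi_div_two hθ')]
    refine ⟨?_, hz1.le⟩
    have := (abs_nonneg _).trans_lt hz1
    exact pos_of_mul_pos_right this (tan_pos_of_lt hθ (lt_pi_div_two hθ')).le
  refine (measure_mono hsub).trans ((prob_patternEvent_le hΦ hl (isOpen_sectorRegion θ n)
    (volume_sectorRegion_ne_top hθ hθ') (hT.inter hKc)).trans ?_)
  refine (setLIntegral_mono' (hT.inter hKc).measurableSet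
    (g := pathDensity l θ) fun v hv => ?_).trans (lintegral_mono_set Set.inter_subset_left)
  rw [volume_sectorRegion hθ hθ' hv.2, pathDensity]
  have h1 : ∀ i, stepDensity l θ (step v i)
      = ENNReal.ofReal (l * Real.exp (-(l * θ * ‖step v i‖ ^ 2))) := fun i =>
    Set.indicator_of_mem (hv.2 i) _
  simp only [h1]
  rw [← ENNReal.ofReal_prod_of_nonneg (fun i _ => by positivity), ← ENNReal.ofReal_pow hl,
    ← ENNReal.ofReal_mul (by positivity), Finset.prod_mul_distrib, ← Real.exp_sum]
  simp only [Finset.prod_const, Finset.card_univ, Fintype.card_fin, Finset.mul_sum,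
    Finset.sum_neg_distrib, mul_assoc, le_refl]

end Path

section Laplace

/-! ### The law of a step and its Laplace transform -/

variable {l θ : ℝ}

/-- The law of a step of the navigation. -/
noncomputable def stepMeasure (l θ : ℝ) : Measure Plane := volume.withDensity (stepDensity l θ)

/-- The Laplace transform of the law of a step. -/
noncomputable def laplace (l θ : ℝ) (γ : Plane) : ℝ :=
  ∫ w, Real.exp (inner ℝ γ w) ∂stepMeasure l θ

lemma integral_mul_exp_neg_mul_sq {b : ℝ} (hb : 0 < b) :
    ∫ r in Set.Ioi (0 : ℝ), r * Real.exp (-(b * r ^ 2)) = (2 * b)⁻¹ := by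
  have h := integral_mul_cexp_neg_mul_sq (b := (b : ℂ)) (by simpa using hb)
  have h2 : ∀ r : ℝ, (r : ℂ) * Complex.exp (-(b : ℂ) * (r : ℂ) ^ 2)
      = ((r * Real.exp (-(b * r ^ 2)) : ℝ) : ℂ) := by
    intro r; push_cast; ring_nf
  simp only [h2] at h
  rw [integral_complex_ofReal] at h
  exact_mod_cast h

lemma lintegral_stepDensity_mul (hl : 0 < l) (hθ : 0 < θ) (hθ' : θ ≤ Real.pi / 4)
    {F : Plane → ℝ} (hF : Continuous F) (hF0 : ∀ w, 0 ≤ F w) :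
    ∫⁻ w, stepDensity l θ w * ENNReal.ofReal (F w) = ∫⁻ r in Set.Ioi (0 : ℝ),
      ENNReal.ofReal (l * (r * Real.exp (-(l * θ * r ^ 2)) *
        ∫ φ in (-θ)..θ, F !₂[r * Real.cos φ, r * Real.sin φ])) := by
  have hm : Measurable fun w => stepDensity l θ w * ENNReal.ofReal (F w) :=
    (measurable_stepDensity l θ).mul (ENNReal.measurable_ofReal.comp hF.measurable)
  rw [lintegral_plane_polar hm]
  refine setLIntegral_congr_fun measurableSet_Ioi fun r hr => ?_
  rw [Set.mem_Ioi] at hr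
  have hcont : Continuous fun φ : ℝ => F !₂[r * Real.cos φ, r * Real.sin φ] := by
    refine hF.comp ?_
    refine (PiLp.continuous_toLp 2 _).comp (continuous_pi fun i => ?_)
    fin_cases i <;> simp <;> fun_prop
  have h1 : ∀ φ ∈ Set.Ioo (-Real.pi) Real.pi,
      ENNReal.ofReal r * (stepDensity l θ !₂[r * Real.cos φ, r * Real.sin φ] *
        ENNReal.ofReal (F !₂[r * Real.cos φ, r * Real.sin φ]))
      = (Set.Icc (-θ) θ).indicator (fun φ => ENNReal.ofReal (l * (r * Real.exp (-(l * θ * r ^ 2)))) *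
          ENNReal.ofReal (F !₂[r * Real.cos φ, r * Real.sin φ])) φ := by
    intro φ hφ
    have hmem : (!₂[r * Real.cos φ, r * Real.sin φ] : Plane) ∈ closedCone θ ↔ |φ| ≤ θ := by
      simp only [closedCone, Set.mem_ofPred_eq]
      rw [← abs_sin_le_iff hθ (lt_pi_div_two hθ') (abs_lt.2 hφ)]
      simp only [Matrix.cons_val_zero, Matrix.cons_val_one, abs_mul, abs_of_pos hr]
      rw [mul_left_comm, mul_le_mul_iff_right₀ hr]
    by_cases h2 : |φ| ≤ θ
    · rw [Set.indicator_of_mem (show φ ∈ Set.Icc (-θ) θ from abs_le.1 h2), stepDensity,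
        Set.indicator_of_mem (hmem.2 h2), norm_polar hr.le, ← mul_assoc, ← ENNReal.ofReal_mul hr.le]
      congr 2; ring
    · rw [Set.indicator_of_notMem (show φ ∉ Set.Icc (-θ) θ from fun h => h2 (abs_le.2 h)),
        stepDensity, Set.indicator_of_notMem (fun h => h2 (hmem.1 h)), zero_mul, mul_zero]
  have hpi : θ < Real.pi := (lt_pi_div_two hθ').trans (by linarith [Real.pi_pos])
  rw [setLIntegral_congr_fun measurableSet_Ioo h1, setLIntegral_indicator measurableSet_Icc,
    Set.inter_eq_left.2 (Set.Icc_subset_Ioo (by linarith) hpi),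
    lintegral_const_mul _ (by fun_prop), ← ofReal_integral_eq_lintegral_ofReal,
    ← ENNReal.ofReal_mul (by positivity), integral_Icc_eq_integral_Ioc,
    ← intervalIntegral.integral_of_le (by linarith), mul_assoc]
  · exact hcont.integrableOn_Icc
  · exact ae_of_all _ fun φ => hF0 _

lemma lintegral_stepDensity (hl : 0 < l) (hθ : 0 < θ) (hθ' : θ ≤ Real.pi / 4) :
    ∫⁻ w, stepDensity l θ w = 1 := by
  have h := lintegral_stepDensity_mul hl hθ hθ' (F := fun _ => 1) continuous_const
    (fun _ => zero_le_one)
  simp only [ENNReal.ofReal_one, mul_one, intervalIntegral.integral_const, smul_eq_mul] at h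
  have hb : 0 < l * θ := by positivity
  rw [h, ← ofReal_integral_eq_lintegral_ofReal]
  · rw [integral_const_mul, integral_mul_const, integral_mul_exp_neg_mul_sq hb]
    rw [← ENNReal.ofReal_one]; congr 1; field_simp; ring
  · have := (integrable_mul_exp_neg_mul_sq hb).integrableOn (s := Set.Ioi (0 : ℝ))
    refine (this.mul_const (θ - -θ)).const_mul l |>.congr (ae_of_all _ fun r => ?_)
    simp only [neg_mul]
  · filter_upwards [ae_restrict_mem measurableSet_Ioi] with r hr
    have : (0 : ℝ) < r := hr
    have : 0 ≤ θ - -θ := by linarith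
    positivity

lemma isProbabilityMeasure_stepMeasure (hl : 0 < l) (hθ : 0 < θ) (hθ' : θ ≤ Real.pi / 4) :
    IsProbabilityMeasure (stepMeasure l θ) := by
  refine ⟨?_⟩
  rw [stepMeasure, withDensity_apply _ MeasurableSet.univ, Measure.restrict_univ,
    lintegral_stepDensity hl hθ hθ']

lemma stepDensity_lt_top (w : Plane) : stepDensity l θ w < ⊤ := by
  classical
  rw [stepDensity, Set.indicator_apply]
  split_ifs <;> simp

lemma lintegral_stepMeasure {F : Plane → ENNReal} (hF : Measurable F) :
    ∫⁻ w, F w ∂stepMeasure l θ = ∫⁻ w, stepDensity l θ w * F w := by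
  rw [stepMeasure, lintegral_withDensity_eq_lintegral_mul _ (measurable_stepDensity l θ) hF]
  rfl

lemma integrable_exp_neg_mul_sq_norm {b : ℝ} (hb : 0 < b) :
    Integrable fun w : Plane => Real.exp (-(b * ‖w‖ ^ 2)) := by
  have h := (GaussianFourier.integrable_cexp_neg_mul_sq_norm_add (V := Plane) (b := (b : ℂ))
    (by simpa using hb) 0 0).norm
  refine h.congr (ae_of_all _ fun w => ?_)
  simp only [Complex.norm_exp]
  congr 1
  simp [← Complex.ofReal_pow]

lemma integrable_exp_mul_norm (hl : 0 < l) (hθ : 0 < θ) (c : ℝ) :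
    Integrable (fun w => Real.exp (c * ‖w‖)) (stepMeasure l θ) := by
  have hb : 0 < l * θ := by positivity
  rw [stepMeasure, integrable_withDensity_iff_integrable_smul' (measurable_stepDensity l θ)
    (ae_of_all _ stepDensity_lt_top)]
  have hb2 : 0 < l * θ / 2 := by positivity
  refine ((integrable_exp_neg_mul_sq_norm hb2).const_mul
    (l * Real.exp (c ^ 2 / (2 * (l * θ))))).mono' ?_ (ae_of_all _ fun w => ?_)
  · exact ((measurable_stepDensity l θ).ennreal_toReal.smul (by fun_prop)).aestronglyMeasurable
  · have h1 : (stepDensity l θ w).toReal ≤ l * Real.exp (-(l * θ * ‖w‖ ^ 2)) := by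
      classical
      rw [stepDensity, Set.indicator_apply]
      split_ifs
      · rw [ENNReal.toReal_ofReal (by positivity)]
      · simp only [ENNReal.toReal_zero]; positivity
    rw [smul_eq_mul, norm_mul, Real.norm_of_nonneg ENNReal.toReal_nonneg,
      Real.norm_of_nonneg (Real.exp_pos _).le]
    refine (mul_le_mul_of_nonneg_right h1 (Real.exp_pos _).le).trans ?_
    rw [mul_assoc l, mul_assoc l (Real.exp _), ← Real.exp_add, ← Real.exp_add]
    refine mul_le_mul_of_nonneg_left (Real.exp_le_exp.2 ?_) hl.le
    have h2 : c ^ 2 / (2 * (l * θ)) + -(l * θ / 2 * ‖w‖ ^ 2)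
        - (-(l * θ * ‖w‖ ^ 2) + c * ‖w‖) = (l * θ * ‖w‖ - c) ^ 2 / (2 * (l * θ)) := by
      field_simp; ring
    have h3 : 0 ≤ (l * θ * ‖w‖ - c) ^ 2 / (2 * (l * θ)) := by positivity
    linarith

lemma integrable_exp_inner_add (hl : 0 < l) (hθ : 0 < θ) (γ : Plane) (c : ℝ) :
    Integrable (fun w => Real.exp (inner ℝ γ w + c * ‖w‖)) (stepMeasure l θ) := by
  refine (integrable_exp_mul_norm hl hθ (‖γ‖ + c)).mono' (by fun_prop) (ae_of_all _ fun w => ?_)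
  rw [Real.norm_of_nonneg (Real.exp_pos _).le]
  apply Real.exp_le_exp.2
  have := real_inner_le_norm γ w
  linarith

lemma integrable_exp_inner (hl : 0 < l) (hθ : 0 < θ) (γ : Plane) :
    Integrable (fun w => Real.exp (inner ℝ γ w)) (stepMeasure l θ) := by
  simpa using integrable_exp_inner_add hl hθ γ 0

lemma lintegral_exp_inner (hl : 0 < l) (hθ : 0 < θ) (γ : Plane) :
    ∫⁻ w, ENNReal.ofReal (Real.exp (inner ℝ γ w)) ∂stepMeasure l θ
      = ENNReal.ofReal (laplace l θ γ) := by
  rw [laplace, ofReal_integral_eq_lintegral_ofReal (integrable_exp_inner hl hθ γ)]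
  exact ae_of_all _ fun w => (Real.exp_pos _).le

lemma lintegral_stepDensity_exp (hl : 0 < l) (hθ : 0 < θ) (γ : Plane) :
    ∫⁻ w, stepDensity l θ w * ENNReal.ofReal (Real.exp (inner ℝ γ w))
      = ENNReal.ofReal (laplace l θ γ) := by
  rw [← lintegral_exp_inner hl hθ, lintegral_stepMeasure (by fun_prop)]

lemma laplace_pos (hl : 0 < l) (hθ : 0 < θ) (hθ' : θ ≤ Real.pi / 4) (γ : Plane) :
    0 < laplace l θ γ := by
  have := isProbabilityMeasure_stepMeasure hl hθ hθ'
  exact integral_exp_pos (integrable_exp_inner hl hθ γ)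

lemma laplace_zero (hl : 0 < l) (hθ : 0 < θ) (hθ' : θ ≤ Real.pi / 4) : laplace l θ 0 = 1 := by
  have := isProbabilityMeasure_stepMeasure hl hθ hθ'
  simp [laplace]

lemma inner_plane (γ w : Plane) : inner ℝ γ w = γ 0 * w 0 + γ 1 * w 1 := by
  rw [PiLp.inner_apply, Fin.sum_univ_two]
  simp [mul_comm]

lemma logMGF_eq (hl : 0 < l) (hθ : 0 < θ) (hθ' : θ ≤ Real.pi / 4) (γ : Plane) :
    logMGF l θ γ = Real.log (laplace l θ γ) := by
  rw [logMGF]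
  congr 1
  have h := lintegral_stepDensity_mul hl hθ hθ' (F := fun w => Real.exp (inner ℝ γ w))
    (by fun_prop) (fun _ => (Real.exp_pos _).le)
  rw [lintegral_stepDensity_exp hl hθ] at h
  have hcoord : ∀ r φ : ℝ, inner ℝ γ (!₂[r * Real.cos φ, r * Real.sin φ] : Plane)
      = γ 0 * r * Real.cos φ + γ 1 * r * Real.sin φ := by
    intro r φ; rw [inner_plane]; simp [mul_assoc]
  simp only [hcoord] at h
  have hcont : Continuous fun r : ℝ => ∫ φ in (-θ)..θ,
      Real.exp (γ 0 * r * Real.cos φ + γ 1 * r * Real.sin φ) :=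
    intervalIntegral.continuous_parametric_intervalIntegral_of_continuous' (by fun_prop) _ _
  have h2 := congrArg ENNReal.toReal h
  rw [ENNReal.toReal_ofReal (laplace_pos hl hθ hθ' γ).le] at h2
  rw [h2, ← integral_const_mul, integral_eq_lintegral_of_nonneg_ae]
  · filter_upwards [ae_restrict_mem measurableSet_Ioi] with r hr
    have hr' : (0 : ℝ) < r := hr
    have : 0 ≤ ∫ φ in (-θ)..θ, Real.exp (γ 0 * r * Real.cos φ + γ 1 * r * Real.sin φ) :=
      intervalIntegral.integral_nonneg (by linarith) fun φ _ => (Real.exp_pos _).le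
    simp only [Pi.zero_apply]
    positivity
  · exact (by fun_prop : Continuous _).aestronglyMeasurable

lemma exp_logMGF (hl : 0 < l) (hθ : 0 < θ) (hθ' : θ ≤ Real.pi / 4) (γ : Plane) :
    Real.exp (logMGF l θ γ) = laplace l θ γ := by
  rw [logMGF_eq hl hθ hθ', Real.exp_log (laplace_pos hl hθ hθ' γ)]

lemma convexOn_logMGF (hl : 0 < l) (hθ : 0 < θ) (hθ' : θ ≤ Real.pi / 4) :
    ConvexOn ℝ Set.univ (logMGF l θ) := by
  refine ⟨convex_univ, fun γ _ γ' _ a b ha hb hab => ?_⟩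
  have hp := laplace_pos hl hθ hθ'
  have key := ENNReal.lintegral_mul_norm_pow_le (μ := stepMeasure l θ)
    (f := fun w => ENNReal.ofReal (Real.exp (inner ℝ γ w)))
    (g := fun w => ENNReal.ofReal (Real.exp (inner ℝ γ' w)))
    (by fun_prop) (by fun_prop) ha hb hab
  rw [lintegral_exp_inner hl hθ, lintegral_exp_inner hl hθ,
    ENNReal.ofReal_rpow_of_pos (hp γ), ENNReal.ofReal_rpow_of_pos (hp γ'),
    ← ENNReal.ofReal_mul (Real.rpow_nonneg (hp γ).le _)] at key
  have h1 : ∀ w, ENNReal.ofReal (Real.exp (inner ℝ γ w)) ^ a *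
      ENNReal.ofReal (Real.exp (inner ℝ γ' w)) ^ b
      = ENNReal.ofReal (Real.exp (inner ℝ (a • γ + b • γ') w)) := by
    intro w
    rw [ENNReal.ofReal_rpow_of_pos (Real.exp_pos _), ENNReal.ofReal_rpow_of_pos (Real.exp_pos _),
      ← ENNReal.ofReal_mul (Real.rpow_nonneg (Real.exp_pos _).le _), ← Real.exp_mul,
      ← Real.exp_mul, ← Real.exp_add, inner_add_left, real_inner_smul_left, real_inner_smul_left]
    congr 2; ring
  simp only [h1] at key
  rw [lintegral_exp_inner hl hθ, ENNReal.ofReal_le_ofReal_iff (by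
    have := hp γ; have := hp γ'; positivity)] at key
  rw [logMGF_eq hl hθ hθ', logMGF_eq hl hθ hθ', logMGF_eq hl hθ hθ', smul_eq_mul, smul_eq_mul]
  refine (Real.log_le_log (hp _) key).trans_eq ?_
  rw [Real.log_mul (Real.rpow_pos_of_pos (hp γ) _).ne' (Real.rpow_pos_of_pos (hp γ') _).ne',
    Real.log_rpow (hp γ), Real.log_rpow (hp γ')]

lemma continuous_logMGF (hl : 0 < l) (hθ : 0 < θ) (hθ' : θ ≤ Real.pi / 4) :
    Continuous (logMGF l θ) :=
  continuousOn_univ.1 ((convexOn_logMGF hl hθ hθ').continuousOn isOpen_univ)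

lemma ae_mem_closedCone : ∀ᵐ w ∂stepMeasure l θ, w ∈ closedCone θ := by
  rw [stepMeasure, ae_withDensity_iff (measurable_stepDensity l θ)]
  refine ae_of_all _ fun w hw => ?_
  by_contra h
  exact hw (Set.indicator_of_notMem h _)

/-- The Laplace transform vanishes at infinity in the directions of the polar cone. -/
lemma exists_laplace_lt (hl : 0 < l) (hθ : 0 < θ) (hθ' : θ ≤ Real.pi / 4) {ξ : Plane} (hξ : ξ ≠ 0)
    (hcone : ∀ w ∈ closedCone θ, inner ℝ ξ w ≤ 0) {ε : ℝ} (hε : 0 < ε) :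
    ∃ s : ℕ, laplace l θ ((s : ℝ) • ξ) < ε := by
  have := isProbabilityMeasure_stepMeasure hl hθ hθ'
  have hnull : ∀ᵐ w ∂stepMeasure l θ, inner ℝ ξ w < 0 := by
    have h1 : volume {w : Plane | inner ℝ ξ w = 0} = 0 := by
      have hne : (innerSL ℝ ξ : Plane →L[ℝ] ℝ).toLinearMap.ker ≠ ⊤ := by
        intro h
        have : ξ ∈ (innerSL ℝ ξ : Plane →L[ℝ] ℝ).toLinearMap.ker := h ▸ Submodule.mem_top
        simp [LinearMap.mem_ker] at this
        exact hξ this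
      refine measure_mono_null (fun w hw => ?_)
        (Measure.addHaar_submodule (volume : Measure Plane) _ hne)
      simpa [LinearMap.mem_ker] using hw
    have h2 : ∀ᵐ w ∂stepMeasure l θ, inner ℝ ξ w ≠ 0 := by
      refine (withDensity_absolutelyContinuous _ _).ae_le (?_ : ∀ᵐ w ∂volume, inner ℝ ξ w ≠ 0)
      rw [ae_iff]; simpa using h1
    filter_upwards [ae_mem_closedCone, h2] with w hw1 hw2
    exact lt_of_le_of_ne (hcone w hw1) hw2
  have hlim : Tendsto (fun s : ℕ => laplace l θ ((s : ℝ) • ξ)) atTop (𝓝 (∫ _, (0 : ℝ) ∂stepMeasure l θ)) := by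
    refine tendsto_integral_of_dominated_convergence (fun _ => 1) (fun s => by fun_prop)
      (integrable_const 1) (fun s => ?_) ?_
    · filter_upwards [hnull] with w hw
      rw [Real.norm_of_nonneg (Real.exp_pos _).le, Real.exp_le_one_iff, real_inner_smul_left]
      exact mul_nonpos_of_nonneg_of_nonpos (by positivity) hw.le
    · filter_upwards [hnull] with w hw
      simp only [real_inner_smul_left]
      exact Real.tendsto_exp_atBot.comp (tendsto_natCast_atTop_atTop.atTop_mul_const_of_neg hw)
  rw [integral_zero] at hlim
  exact (hlim.eventually (gt_mem_nhds hε)).exists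

end Laplace

section Rate

/-! ### Tilting: minimizers of the dual problem -/

variable {l θ : ℝ}

lemma stepMeasure_pos_of_isOpen (hl : 0 < l) {U : Set Plane} (hU : IsOpen U)
    (hne : U.Nonempty) (hsub : U ⊆ closedCone θ) : 0 < stepMeasure l θ U := by
  rw [stepMeasure, withDensity_apply _ hU.measurableSet, pos_iff_ne_zero]
  intro h
  rw [lintegral_eq_zero_iff (measurable_stepDensity l θ)] at h
  have h1 : ∀ᵐ w ∂volume.restrict U, False := by
    filter_upwards [h, ae_restrict_mem hU.measurableSet] with w hw hwU
    rw [stepDensity, Set.indicator_of_mem (hsub hwU)] at hw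
    simp only [Pi.zero_apply, ENNReal.ofReal_eq_zero] at hw
    have : 0 < l * Real.exp (-(l * θ * ‖w‖ ^ 2)) := by positivity
    linarith
  simp only [eventually_false_iff_eq_bot, ae_eq_bot, Measure.restrict_eq_zero] at h1
  exact (hU.measure_pos volume hne).ne' h1

lemma exists_laplace_ge (hl : 0 < l) (hθ : 0 < θ) (hθ' : θ ≤ Real.pi / 4) {u : Plane}
    (hu : |u 1| < Real.tan θ * u 0) :
    ∃ p > 0, ∃ η > 0, ∀ γ : Plane,
      p * Real.exp (inner ℝ γ u + η * ‖γ‖) ≤ laplace l θ γ := by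
  have := isProbabilityMeasure_stepMeasure hl hθ hθ'
  have hk := tan_pos_of_lt hθ (lt_pi_div_two hθ')
  have hk1 := tan_le_one hθ hθ'
  set η : ℝ := (Real.tan θ * u 0 - |u 1|) / 4 with hη
  have hη0 : 0 < η := by rw [hη]; linarith
  let sg : Bool → ℝ := fun b => if b then 1 else -1
  have hsg : ∀ b, sg b * sg b = 1 := by intro b; cases b <;> simp [sg]
  let Q : (Fin 2 → Bool) → Set Plane := fun σ =>
    {w | ∀ i, η < sg (σ i) * (w i - u i) ∧ sg (σ i) * (w i - u i) < 2 * η}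
  have hQopen : ∀ σ, IsOpen (Q σ) := by
    intro σ
    simp only [Q, Set.ofPred_forall]
    refine isOpen_iInter_of_finite fun i => ?_
    have h1 : IsOpen {w : Plane | η < sg (σ i) * (w i - u i)} :=
      isOpen_lt (by fun_prop) (by fun_prop)
    have h2 : IsOpen {w : Plane | sg (σ i) * (w i - u i) < 2 * η} :=
      isOpen_lt (by fun_prop) (by fun_prop)
    exact h1.inter h2
  have hQne : ∀ σ, (Q σ).Nonempty := by
    intro σ
    refine ⟨WithLp.toLp 2 fun i => u i + sg (σ i) * (3 / 2 * η), fun i => ?_⟩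
    have h1 : sg (σ i) * ((u i + sg (σ i) * (3 / 2 * η)) - u i) = 3 / 2 * η := by
      rw [add_sub_cancel_left, ← mul_assoc, hsg, one_mul]
    simp only [h1]
    constructor <;> linarith
  have hQabs : ∀ σ, ∀ w ∈ Q σ, ∀ i, |w i - u i| ≤ 2 * η := by
    intro σ w hw i
    have h1 := hw i
    cases hσ : σ i
    · simp only [hσ, sg] at h1
      rw [abs_le]; constructor <;> simp at h1 <;> linarith
    · simp only [hσ, sg] at h1
      rw [abs_le]; constructor <;> simp at h1 <;> linarith
  have hQsub : ∀ σ, Q σ ⊆ closedCone θ := by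
    intro σ w hw
    have h0 := abs_le.1 (hQabs σ w hw 0)
    have h1 := hQabs σ w hw 1
    have h2 : |w 1| ≤ |u 1| + 2 * η := by
      have := abs_add_le (u 1) (w 1 - u 1)
      rw [add_sub_cancel] at this
      linarith
    simp only [closedCone, Set.mem_ofPred_eq]
    nlinarith
  have hQpos : ∀ σ, 0 < (stepMeasure l θ).real (Q σ) := fun σ =>
    ENNReal.toReal_pos (stepMeasure_pos_of_isOpen hl (hQopen σ) (hQne σ) (hQsub σ)).ne'
      (measure_ne_top _ _)
  obtain ⟨σ₀, hσ₀⟩ := Finite.exists_min fun σ => (stepMeasure l θ).real (Q σ)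
  refine ⟨_, hQpos σ₀, η, hη0, fun γ => ?_⟩
  let σ : Fin 2 → Bool := fun i => decide (0 ≤ γ i)
  have hsgγ : ∀ i, γ i = |γ i| * sg (σ i) := by
    intro i
    by_cases h : 0 ≤ γ i
    · simp [σ, sg, h, abs_of_nonneg h]
    · simp [σ, sg, h, abs_of_neg (not_le.1 h)]
  have hnorm : ‖γ‖ ≤ |γ 0| + |γ 1| := by
    rw [EuclideanSpace.norm_eq, Fin.sum_univ_two]
    apply Real.sqrt_le_iff.2 ⟨by positivity, ?_⟩
    simp only [Real.norm_eq_abs]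
    nlinarith [abs_nonneg (γ 0), abs_nonneg (γ 1), mul_nonneg (abs_nonneg (γ 0)) (abs_nonneg (γ 1))]
  have hQγ : ∀ w ∈ Q σ, Real.exp (inner ℝ γ u + η * ‖γ‖) ≤ Real.exp (inner ℝ γ w) := by
    intro w hw
    apply Real.exp_le_exp.2
    rw [inner_plane, inner_plane]
    have h0 : η * |γ 0| ≤ γ 0 * (w 0 - u 0) := by
      rw [mul_comm, hsgγ 0, abs_mul, abs_abs, mul_assoc, mul_assoc]
      have : |sg (σ 0)| = 1 := by cases σ 0 <;> simp [sg]
      rw [this, one_mul]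
      exact mul_le_mul_of_nonneg_left (hw 0).1.le (abs_nonneg _)
    have h1 : η * |γ 1| ≤ γ 1 * (w 1 - u 1) := by
      rw [mul_comm, hsgγ 1, abs_mul, abs_abs, mul_assoc, mul_assoc]
      have : |sg (σ 1)| = 1 := by cases σ 1 <;> simp [sg]
      rw [this, one_mul]
      exact mul_le_mul_of_nonneg_left (hw 1).1.le (abs_nonneg _)
    have := mul_le_mul_of_nonneg_left hnorm hη0.le
    linarith
  have hint := integrable_exp_inner hl hθ γ (l := l)
  calc _ ≤ (stepMeasure l θ).real (Q σ) * Real.exp (inner ℝ γ u + η * ‖γ‖) :=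
        mul_le_mul_of_nonneg_right (hσ₀ σ) (Real.exp_pos _).le
    _ = ∫ _ in Q σ, Real.exp (inner ℝ γ u + η * ‖γ‖) ∂stepMeasure l θ := by
        rw [setIntegral_const, smul_eq_mul]
    _ ≤ ∫ w in Q σ, Real.exp (inner ℝ γ w) ∂stepMeasure l θ :=
        setIntegral_mono_on (by simp) hint.integrableOn (hQopen σ).measurableSet hQγ
    _ ≤ laplace l θ γ := setIntegral_le_integral hint (ae_of_all _ fun w => (Real.exp_pos _).le)

/-- In the open cone, the supremum in the Legendre transform is attained. -/
lemma exists_minimizer (hl : 0 < l) (hθ : 0 < θ) (hθ' : θ ≤ Real.pi / 4) {u : Plane}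
    (hu : |u 1| < Real.tan θ * u 0) :
    ∃ γ : Plane, ∀ γ', logMGF l θ γ - inner ℝ γ u ≤ logMGF l θ γ' - inner ℝ γ' u := by
  obtain ⟨p, hp, η, hη, h⟩ := exists_laplace_ge hl hθ hθ' hu
  have hcont := continuous_logMGF hl hθ hθ'
  refine Continuous.exists_forall_le (f := fun γ => logMGF l θ γ - inner ℝ γ u)
    (by fun_prop) ?_
  have h1 : Tendsto (fun γ : Plane => Real.log p + η * ‖γ‖) (cocompact Plane) atTop :=
    tendsto_atTop_add_const_left _ _ ((tendsto_norm_cocompact_atTop).const_mul_atTop hη)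
  refine tendsto_atTop_mono (fun γ => ?_) h1
  have h2 := Real.log_le_log (by positivity) (h γ)
  rw [Real.log_mul hp.ne' (Real.exp_pos _).ne', Real.log_exp, ← logMGF_eq hl hθ hθ'] at h2
  linarith

lemma hasDerivAt_laplace (hl : 0 < l) (hθ : 0 < θ) (γ e : Plane) :
    ∃ d, HasDerivAt (fun s : ℝ => laplace l θ (γ + s • e)) d 0 := by
  let μ := (stepMeasure l θ).withDensity fun w => ENNReal.ofReal (Real.exp (inner ℝ γ w))
  have hm : Measurable fun w : Plane => ENNReal.ofReal (Real.exp (inner ℝ γ w)) := by fun_prop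
  have htop : ∀ᵐ w ∂stepMeasure l θ, ENNReal.ofReal (Real.exp (inner ℝ γ w)) < ⊤ :=
    ae_of_all _ fun w => ENNReal.ofReal_lt_top
  have hexp : ∀ (s : ℝ) (w : Plane), (ENNReal.ofReal (Real.exp (inner ℝ γ w))).toReal •
      Real.exp (s * inner ℝ e w) = Real.exp (inner ℝ (γ + s • e) w) := by
    intro s w
    rw [ENNReal.toReal_ofReal (Real.exp_pos _).le, smul_eq_mul, ← Real.exp_add, inner_add_left,
      real_inner_smul_left]
  have hset : integrableExpSet (fun w => inner ℝ e w) μ = Set.univ := by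
    refine Set.eq_univ_of_forall fun s => ?_
    have : Integrable (fun w => Real.exp (s * inner ℝ e w)) μ := by
      rw [integrable_withDensity_iff_integrable_smul' hm htop]
      simp only [hexp]
      exact integrable_exp_inner hl hθ _
    exact this
  have hmgf : mgf (fun w => inner ℝ e w) μ = fun s : ℝ => laplace l θ (γ + s • e) := by
    funext s
    rw [mgf, integral_withDensity_eq_integral_toReal_smul hm htop]
    simp only [hexp]
    rfl
  refine ⟨_, hmgf ▸ hasDerivAt_mgf (t := 0) ?_⟩
  rw [hset, interior_univ]
  trivial

/-- At a minimizer, the tilted step has mean `u`, in the form of exponential bounds. -/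
lemma exists_tilt_lt (hl : 0 < l) (hθ : 0 < θ) (hθ' : θ ≤ Real.pi / 4) {u γ : Plane}
    (hγ : ∀ γ', logMGF l θ γ - inner ℝ γ u ≤ logMGF l θ γ' - inner ℝ γ' u) (e : Plane)
    {ε : ℝ} (hε : 0 < ε) :
    ∃ s > 0, logMGF l θ (γ + s • e) < logMGF l θ γ + s * (inner ℝ e u + ε) := by
  obtain ⟨d, hd⟩ := hasDerivAt_laplace (l := l) hl hθ γ e
  have hlog : HasDerivAt (fun s : ℝ => logMGF l θ (γ + s • e)) (d / laplace l θ γ) 0 := by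
    have := hd.log (laplace_pos hl hθ hθ' _).ne'
    simp only [zero_smul, add_zero] at this
    refine this.congr_of_eventuallyEq (Eventually.of_forall fun s => ?_)
    exact logMGF_eq hl hθ hθ' _
  set D := d / laplace l θ γ
  have hlin : ∀ c : ℝ, HasDerivAt (fun s : ℝ => logMGF l θ (γ + s • e) - s * c) (D - c) 0 := by
    intro c
    have := hlog.sub ((hasDerivAt_id (0 : ℝ)).mul_const c)
    rw [one_mul] at this
    exact this
  have hmin : IsLocalMin (fun s : ℝ => logMGF l θ (γ + s • e) - s * inner ℝ e u) 0 := by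
    refine Eventually.of_forall fun s => ?_
    have := hγ (γ + s • e)
    rw [inner_add_left, real_inner_smul_left] at this
    simp only [zero_smul, add_zero, zero_mul, sub_zero]
    linarith
  have hD : D - inner ℝ e u = 0 := hmin.hasDerivAt_eq_zero (hlin _)
  have hneg := hlin (inner ℝ e u + ε)
  by_contra! hcon
  have hslope := hneg.tendsto_slope_zero_right
  have : 0 ≤ D - (inner ℝ e u + ε) := by
    refine ge_of_tendsto hslope ?_
    filter_upwards [self_mem_nhdsWithin] with s hs
    have h1 := hcon s hs
    have hs' : (0 : ℝ) < s := hs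
    simp only [zero_add, zero_smul, add_zero, zero_mul, sub_zero, smul_eq_mul]
    refine mul_nonneg (by positivity) ?_
    linarith
  linarith

/-! ### The rate function -/

lemma logMGF_zero (hl : 0 < l) (hθ : 0 < θ) (hθ' : θ ≤ Real.pi / 4) : logMGF l θ 0 = 0 := by
  rw [logMGF_eq hl hθ hθ', laplace_zero hl hθ hθ', Real.log_one]

lemma le_stepRate (γ u : Plane) :
    ((inner ℝ γ u - logMGF l θ γ : ℝ) : EReal) ≤ stepRate l θ u :=
  le_iSup (fun γ : Plane => ((inner ℝ γ u - logMGF l θ γ : ℝ) : EReal)) γ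

lemma stepRate_nonneg (hl : 0 < l) (hθ : 0 < θ) (hθ' : θ ≤ Real.pi / 4) (u : Plane) :
    0 ≤ stepRate l θ u := by
  refine le_trans ?_ (le_stepRate 0 u)
  rw [logMGF_zero hl hθ hθ']; simp

lemma mem_openCone_of_stepRate_ne_top (hl : 0 < l) (hθ : 0 < θ) (hθ' : θ ≤ Real.pi / 4) {u : Plane}
    (hu : stepRate l θ u ≠ ⊤) : |u 1| < Real.tan θ * u 0 := by
  by_contra! hcon
  have key : ∀ ξ : Plane, ξ ≠ 0 → (∀ w ∈ closedCone θ, inner ℝ ξ w ≤ 0) → 0 ≤ inner ℝ ξ u →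
      False := by
    intro ξ hξ hcone hξu
    apply hu
    rw [EReal.eq_top_iff_forall_lt]
    intro M
    obtain ⟨s, hs⟩ := exists_laplace_lt hl hθ hθ' hξ hcone (Real.exp_pos (-M))
    refine lt_of_lt_of_le ?_ (le_stepRate ((s : ℝ) • ξ) u)
    rw [EReal.coe_lt_coe_iff, logMGF_eq hl hθ hθ', real_inner_smul_left]
    have := (Real.log_lt_iff_lt_exp (laplace_pos hl hθ hθ' _)).2 hs
    have := mul_nonneg (Nat.cast_nonneg (α := ℝ) s) hξu
    linarith
  rcases le_abs.1 hcon with h | h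
  · refine key !₂[-Real.tan θ, 1] (fun h0 => ?_) (fun w hw => ?_) ?_
    · have := congrArg (fun x : Plane => x 1) h0
      simp at this
    · have h1 : |w 1| ≤ Real.tan θ * w 0 := hw
      rw [inner_plane]; simp
      linarith [le_abs_self (w 1)]
    · rw [inner_plane]; simp; linarith
  · refine key !₂[-Real.tan θ, -1] (fun h0 => ?_) (fun w hw => ?_) ?_
    · have := congrArg (fun x : Plane => x 1) h0
      simp at this
    · have h1 : |w 1| ≤ Real.tan θ * w 0 := hw
      rw [inner_plane]; simp
      linarith [neg_le_abs (w 1)]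
    · rw [inner_plane]; simp; linarith

lemma exists_logMGF_neg (hl : 0 < l) (hθ : 0 < θ) (hθ' : θ ≤ Real.pi / 4) :
    ∃ γ : Plane, logMGF l θ γ < 0 := by
  obtain ⟨s, hs⟩ := exists_laplace_lt (ξ := !₂[-1, 0]) hl hθ hθ' (fun h0 => by
    have := congrArg (fun x : Plane => x 0) h0
    simp at this) (fun w hw => by
      rw [inner_plane]; simpa using coord_nonneg_of_mem_closedCone hθ hθ' hw) one_pos
  exact ⟨_, by rw [logMGF_eq hl hθ hθ']; exact Real.log_neg (laplace_pos hl hθ hθ' _) hs⟩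

lemma le_rate {γ : Plane} (hγ : logMGF l θ γ < 0) (x : ℝ) :
    ((γ 0 + γ 1 * x : ℝ) : EReal) ≤ rate l θ x := by
  refine le_iInf fun ⟨β, hβ⟩ => ?_
  refine le_trans ?_ (mul_le_mul_of_nonneg_left (le_stepRate γ _) (by exact_mod_cast hβ.le))
  rw [← EReal.coe_mul, EReal.coe_le_coe_iff, inner_plane]
  simp only [Matrix.cons_val_zero, Matrix.cons_val_one]
  have : β * (γ 0 * (1 / β) + γ 1 * (x / β) - logMGF l θ γ)
      = γ 0 + γ 1 * x - β * logMGF l θ γ := by field_simp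
  simp only [this]
  nlinarith

lemma rate_nonneg (hl : 0 < l) (hθ : 0 < θ) (hθ' : θ ≤ Real.pi / 4) (x : ℝ) : 0 ≤ rate l θ x :=
  le_iInf fun ⟨_, hβ⟩ =>
    mul_nonneg (by exact_mod_cast hβ.le) (stepRate_nonneg hl hθ hθ' _)

/-- Lagrange duality for the rate function. -/
lemma rate_le_of_forall (hl : 0 < l) (hθ : 0 < θ) (hθ' : θ ≤ Real.pi / 4) {x p : ℝ}
    (h : ∀ γ : Plane, logMGF l θ γ < 0 → γ 0 + γ 1 * x ≤ p) : rate l θ x ≤ p := by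
  have hJ := convexOn_logMGF hl hθ hθ'
  have hJc := continuous_logMGF hl hθ hθ'
  let A : Set (ℝ × ℝ) := {q | ∃ γ : Plane, logMGF l θ γ < q.1 ∧ q.2 < γ 0 + γ 1 * x}
  have hAo : IsOpen A := by
    have : A = ⋃ γ : Plane, {q : ℝ × ℝ | logMGF l θ γ < q.1} ∩ {q | q.2 < γ 0 + γ 1 * x} := by
      ext q; simp [A]
    rw [this]
    exact isOpen_iUnion fun γ => (isOpen_lt continuous_const continuous_fst).inter
      (isOpen_lt continuous_snd continuous_const)
  have hAc : Convex ℝ A := by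
    rintro q ⟨γ, h1, h2⟩ q' ⟨γ', h1', h2'⟩ a b ha hb hab
    refine ⟨a • γ + b • γ', ?_, ?_⟩
    · refine (hJ.2 trivial trivial ha hb hab).trans_lt ?_
      simp only [Prod.fst_add, Prod.smul_fst, smul_eq_mul]
      rcases ha.eq_or_lt with rfl | ha'
      · have : b = 1 := by linarith
        subst this; linarith
      · have := mul_lt_mul_of_pos_left h1 ha'
        have := mul_le_mul_of_nonneg_left h1'.le hb
        linarith
    · simp only [Prod.snd_add, Prod.smul_snd, smul_eq_mul, PiLp.add_apply, PiLp.smul_apply]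
      rcases ha.eq_or_lt with rfl | ha'
      · have : b = 1 := by linarith
        subst this; linarith
      · have := mul_lt_mul_of_pos_left h2 ha'
        have := mul_le_mul_of_nonneg_left h2'.le hb
        linarith
  have hnot : ((0 : ℝ), p) ∉ A := by
    rintro ⟨γ, h1, h2⟩
    exact absurd (h γ h1) (not_le.2 h2)
  obtain ⟨f, hf⟩ := geometric_hahn_banach_open_point hAc hAo hnot
  set b1 := f (1, 0) with hb1
  set b2 := f (0, 1) with hb2
  have hfe : ∀ s w : ℝ, f (s, w) = b1 * s + b2 * w := by
    intro s w
    have : ((s, w) : ℝ × ℝ) = s • (1, 0) + w • (0, 1) := by ext <;> simp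
    rw [this, map_add, map_smul, map_smul, smul_eq_mul, smul_eq_mul, hb1, hb2]; ring
  have hfA : ∀ (γ : Plane) (s w : ℝ), logMGF l θ γ < s → w < γ 0 + γ 1 * x →
      b1 * s + b2 * w < b2 * p := by
    intro γ s w h1 h2
    have := hf (s, w) ⟨γ, h1, h2⟩
    rw [hfe, hfe] at this
    simpa using this
  obtain ⟨γ₀, hγ₀⟩ := exists_logMGF_neg hl hθ hθ'
  have hb2nn : 0 ≤ b2 := by
    by_contra hneg
    push Not at hneg
    set w := min (γ₀ 0 + γ₀ 1 * x - 1) (p - 1)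
    have h1 := hfA γ₀ 0 w hγ₀ ((min_le_left _ _).trans_lt (by linarith))
    have h2 : w ≤ p - 1 := min_le_right _ _
    nlinarith
  have hb2pos : 0 < b2 := by
    rcases hb2nn.eq_or_lt with h0 | h0
    · exfalso
      have h1 := hfA γ₀ 0 (γ₀ 0 + γ₀ 1 * x - 1) hγ₀ (by linarith)
      rw [← h0] at h1
      simp at h1
    · exact h0
  have hb1np : b1 ≤ 0 := by
    by_contra hpos
    push Not at hpos
    set w := γ₀ 0 + γ₀ 1 * x - 1
    have h1 := hfA γ₀ (max 0 (b2 * (p - w) / b1)) w (lt_max_of_lt_left hγ₀) (by simp [w])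
    have h2 : b2 * (p - w) / b1 ≤ max 0 (b2 * (p - w) / b1) := le_max_right _ _
    rw [div_le_iff₀ hpos] at h2
    linarith
  set β := -b1 / b2 with hβ
  have hβ0 : 0 ≤ β := div_nonneg (by linarith) hb2nn
  have hlag : ∀ γ : Plane, γ 0 + γ 1 * x - β * logMGF l θ γ ≤ p := by
    intro γ
    have h1 : ∀ δ > 0, γ 0 + γ 1 * x - β * logMGF l θ γ ≤ p + δ * (1 + β) := by
      intro δ hδ
      have := hfA γ (logMGF l θ γ + δ) (γ 0 + γ 1 * x - δ) (by linarith) (by linarith)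
      have hb : b1 = -(β * b2) := by rw [hβ]; field_simp
      rw [hb] at this
      have h3 : b2 * (γ 0 + γ 1 * x - δ - β * (logMGF l θ γ + δ)) < b2 * p := by linarith
      have := lt_of_mul_lt_mul_left h3 hb2nn
      linarith
    refine le_of_forall_pos_le_add fun ε hε => ?_
    have := h1 (ε / (1 + β)) (by positivity)
    rwa [div_mul_cancel₀ _ (by positivity)] at this
  have hβpos : 0 < β := by
    rcases hβ0.eq_or_lt with h0 | h0
    · exfalso
      have := hlag !₂[p + 1, 0]
      rw [← h0] at this
      simp at this
      linarith
    · exact h0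
  refine (iInf_le _ ⟨β, hβpos⟩).trans ?_
  have hstep : stepRate l θ !₂[1 / β, x / β] ≤ ((p / β : ℝ) : EReal) := by
    refine iSup_le fun γ => ?_
    rw [EReal.coe_le_coe_iff, inner_plane, le_div_iff₀ hβpos]
    refine le_trans (le_of_eq ?_) (hlag γ)
    simp only [Matrix.cons_val_zero, Matrix.cons_val_one, Matrix.cons_val_fin_one]
    field_simp
  refine (mul_le_mul_of_nonneg_left hstep (by exact_mod_cast hβpos.le)).trans ?_
  rw [← EReal.coe_mul, mul_div_cancel₀ _ hβpos.ne']

lemma exists_of_lt_rate (hl : 0 < l) (hθ : 0 < θ) (hθ' : θ ≤ Real.pi / 4) {x a : ℝ}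
    (h : (a : EReal) < rate l θ x) : ∃ γ : Plane, logMGF l θ γ < 0 ∧ a < γ 0 + γ 1 * x := by
  by_contra! hcon
  exact absurd (rate_le_of_forall hl hθ hθ' hcon) (not_le.2 h)

lemma lowerSemicontinuous_rate (hl : 0 < l) (hθ : 0 < θ) (hθ' : θ ≤ Real.pi / 4) :
    LowerSemicontinuous (rate l θ) := by
  intro x y hy
  obtain ⟨a, hya, hax⟩ := EReal.lt_iff_exists_real_btwn.1 hy
  obtain ⟨γ, hγ, hlt⟩ := exists_of_lt_rate hl hθ hθ' hax
  have : ∀ᶠ x' in 𝓝 x, a < γ 0 + γ 1 * x' :=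
    (by fun_prop : Continuous fun x' => γ 0 + γ 1 * x').continuousAt.eventually (lt_mem_nhds hlt)
  filter_upwards [this] with x' hx'
  exact hya.trans ((EReal.coe_lt_coe_iff.2 hx').trans_le (le_rate hγ x'))

end Rate

section Scaling

/-! ### Scaling of the intensity -/

variable {l θ : ℝ}

lemma logMGF_scale (hl : 0 < l) (γ : Plane) :
    logMGF l θ γ = logMGF 1 θ ((√l)⁻¹ • γ) := by
  have hs : 0 < √l := Real.sqrt_pos.2 hl
  have h := integral_comp_mul_left_Ioi (fun r => r * Real.exp (-(1 * θ * r ^ 2)) *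
    ∫ φ in (-θ)..θ, Real.exp (((√l)⁻¹ • γ) 0 * r * Real.cos φ +
      ((√l)⁻¹ • γ) 1 * r * Real.sin φ)) 0 hs
  rw [mul_zero] at h
  rw [logMGF, logMGF]
  congr 1
  have h1 : ∀ r : ℝ, √l * r * Real.exp (-(1 * θ * (√l * r) ^ 2)) *
      (∫ φ in (-θ)..θ, Real.exp (((√l)⁻¹ • γ) 0 * (√l * r) * Real.cos φ +
        ((√l)⁻¹ • γ) 1 * (√l * r) * Real.sin φ))
      = √l * (r * Real.exp (-(l * θ * r ^ 2)) *
        ∫ φ in (-θ)..θ, Real.exp (γ 0 * r * Real.cos φ + γ 1 * r * Real.sin φ)) := by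
    intro r
    have e1 : ∀ i, ((√l)⁻¹ • γ) i * (√l * r) = γ i * r := by
      intro i; simp only [PiLp.smul_apply, smul_eq_mul]; field_simp
    have e2 : 1 * θ * (√l * r) ^ 2 = l * θ * r ^ 2 := by
      rw [mul_pow, Real.sq_sqrt hl.le]; ring
    simp only [e1, e2]; ring
  simp only [h1] at h
  rw [integral_const_mul, smul_eq_mul] at h
  rw [one_mul]
  have h2 := congrArg (fun z => √l * z) h
  rw [mul_inv_cancel_left₀ hs.ne', ← mul_assoc, Real.mul_self_sqrt hl.le] at h2
  exact h2

lemma stepRate_scale (hl : 0 < l) (u : Plane) :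
    stepRate l θ u = stepRate 1 θ (√l • u) := by
  have hs : 0 < √l := Real.sqrt_pos.2 hl
  have key : ∀ γ : Plane, inner ℝ γ u - logMGF l θ γ
      = inner ℝ ((√l)⁻¹ • γ) (√l • u) - logMGF 1 θ ((√l)⁻¹ • γ) := by
    intro γ
    rw [logMGF_scale hl, real_inner_smul_left, real_inner_smul_right, inv_mul_cancel_left₀ hs.ne']
  refine le_antisymm (iSup_le fun γ => ?_) (iSup_le fun γ => ?_)
  · rw [key]; exact le_stepRate _ _
  · have := key (√l • γ)
    rw [smul_smul, inv_mul_cancel₀ hs.ne', one_smul] at this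
    rw [← this]; exact le_stepRate _ _

lemma EReal_coe_mul_iInf {ι : Sort*} {c : ℝ} (hc : 0 < c) (f : ι → EReal) :
    (c : EReal) * ⨅ i, f i = ⨅ i, (c : EReal) * f i := by
  have hcancel : ∀ {d : ℝ}, 0 < d → ∀ a : EReal, (d : EReal) * (((d⁻¹ : ℝ) : EReal) * a) = a := by
    intro d hd a
    rw [← mul_assoc, ← EReal.coe_mul, mul_inv_cancel₀ hd.ne', EReal.coe_one, one_mul]
  refine le_antisymm (le_iInf fun i =>
    mul_le_mul_of_nonneg_left (iInf_le _ i) (by exact_mod_cast hc.le)) ?_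
  rw [← hcancel hc (⨅ i, (c : EReal) * f i)]
  refine mul_le_mul_of_nonneg_left (le_iInf fun i => ?_) (by exact_mod_cast hc.le)
  have h2 := hcancel (inv_pos.2 hc) (f i)
  rw [inv_inv] at h2
  refine le_trans (mul_le_mul_of_nonneg_left (iInf_le _ i)
    (by exact_mod_cast (inv_pos.2 hc).le)) h2.le

lemma rate_scale (hl : 0 < l) (x : ℝ) :
    rate l θ x = ((√l : ℝ) : EReal) * rate 1 θ x := by
  have hs : 0 < √l := Real.sqrt_pos.2 hl
  have key : ∀ β : ℝ, 0 < β → ((√l * β : ℝ) : EReal) *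
      stepRate l θ !₂[1 / (√l * β), x / (√l * β)]
      = ((√l : ℝ) : EReal) * ((β : EReal) * stepRate 1 θ !₂[1 / β, x / β]) := by
    intro β hβ
    have hu : √l • (!₂[1 / (√l * β), x / (√l * β)] : Plane) = !₂[1 / β, x / β] := by
      ext i
      fin_cases i <;> simp <;> field_simp
    rw [stepRate_scale hl, hu, EReal.coe_mul, mul_assoc]
  rw [rate, rate, EReal_coe_mul_iInf hs]
  refine le_antisymm (le_iInf fun ⟨β, hβ⟩ => ?_) (le_iInf fun ⟨β, hβ⟩ => ?_)
  · rw [← key β hβ]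
    exact iInf_le (fun β : {β : ℝ // 0 < β} =>
      ((β : ℝ) : EReal) * stepRate l θ !₂[1 / (β : ℝ), x / (β : ℝ)]) ⟨√l * β, by positivity⟩
  · have h := key (β / √l) (by positivity)
    rw [mul_div_cancel₀ _ hs.ne'] at h
    simp only
    rw [h]
    exact iInf_le (fun β : {β : ℝ // 0 < β} => ((√l : ℝ) : EReal) *
      (((β : ℝ) : EReal) * stepRate 1 θ !₂[1 / (β : ℝ), x / (β : ℝ)])) ⟨β / √l, by positivity⟩

end Scaling

section Waypoints

/-! ### The waypoints of the navigation -/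

variable {l θ : ℝ}

/-- The points of `S` are locally finite and every waypoint has a successor. -/
structure IsNavigable (θ : ℝ) (S : Set Plane) : Prop where
  isSuccessor : ∀ n, IsSuccessor θ S (waypoint θ S n) (waypoint θ S (n + 1))
  finite : ∀ m : ℕ, (S ∩ Metric.closedBall 0 m).Finite

namespace IsNavigable

variable {S : Set Plane}

lemma isSuccessor_successor {v : Plane} (hfin : ∀ m : ℕ, (S ∩ Metric.closedBall 0 m).Finite)
    (hne : (S ∩ cone θ v).Nonempty) : IsSuccessor θ S v (successor θ S v) := by
  have hex : ∃ w, IsSuccessor θ S v w := by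
    obtain ⟨z, hz⟩ := hne
    obtain ⟨m, hm⟩ := exists_nat_ge (dist z v + ‖v‖)
    have hf : (S ∩ cone θ v ∩ {w | dist w v ≤ dist z v}).Finite := by
      refine (hfin m).subset fun w hw => ⟨hw.1.1, ?_⟩
      rw [mem_closedBall_zero_iff]
      have h1 : dist w v ≤ dist z v := hw.2
      have h2 : ‖w‖ ≤ dist w v + ‖v‖ := by
        rw [dist_eq_norm]
        simpa using norm_add_le (w - v) v
      linarith
    obtain ⟨w, hw, hmin⟩ := Set.exists_min_image _ (fun w => dist w v) hf ⟨z, hz, le_refl (dist z v)⟩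
    refine ⟨w, hw.1, fun y hy => ?_⟩
    by_cases h : dist y v ≤ dist z v
    · exact hmin y ⟨hy, h⟩
    · exact le_trans hw.2 (not_le.1 h).le
  rw [successor, dif_pos hex]
  exact hex.choose_spec

lemma of_cone (hfin : ∀ m : ℕ, (S ∩ Metric.closedBall 0 m).Finite)
    (hne : ∀ v, (S ∩ cone θ v).Nonempty) : IsNavigable θ S :=
  ⟨fun _ => isSuccessor_successor hfin (hne _), hfin⟩

variable (h : IsNavigable θ S) (hθ : 0 < θ) (hθ' : θ ≤ Real.pi / 4)

include h hθ hθ'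

lemma sub_mem_closedCone {i j : ℕ} (hij : i ≤ j) :
    waypoint θ S j - waypoint θ S i ∈ closedCone θ := by
  induction j, hij using Nat.le_induction with
  | base => simpa using zero_mem_closedCone θ
  | succ j hij ih =>
    have := add_mem_closedCone (step_mem_of_isSuccessor hθ hθ' (h.isSuccessor j)).1 ih
    simpa using this

lemma strictMono_coord : StrictMono fun n => waypoint θ S n 0 := by
  refine strictMono_nat_of_lt_succ fun n => ?_
  have := (step_mem_of_isSuccessor hθ hθ' (h.isSuccessor n)).2
  rw [PiLp.sub_apply] at this
  linarith

lemma exists_coord_gt (t : ℝ) : ∃ n, t < waypoint θ S n 0 := by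
  by_contra! hcon
  obtain ⟨m, hm⟩ := exists_nat_ge (2 * t)
  have hmem : ∀ n, waypoint θ S (n + 1) ∈ S ∩ Metric.closedBall 0 m := by
    intro n
    refine ⟨(h.isSuccessor n).1.1, ?_⟩
    rw [mem_closedBall_zero_iff]
    have h1 := h.sub_mem_closedCone hθ hθ' (Nat.zero_le (n + 1))
    rw [show waypoint θ S 0 = 0 from rfl, sub_zero] at h1
    have h2 := abs_le_of_mem_closedCone hθ hθ' h1
    have h3 := coord_nonneg_of_mem_closedCone hθ hθ' h1
    have h4 := hcon (n + 1)
    refine le_trans ?_ hm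
    rw [EuclideanSpace.norm_eq, Fin.sum_univ_two]
    apply Real.sqrt_le_iff.2 ⟨by linarith, ?_⟩
    simp only [Real.norm_eq_abs, sq_abs]
    have := sq_le_sq' (abs_le.1 h2).1 (abs_le.1 h2).2
    nlinarith
  have hinj : Function.Injective fun n => waypoint θ S (n + 1) := by
    intro i j hij
    have := (h.strictMono_coord hθ hθ').injective (congrArg (fun w : Plane => w 0) hij)
    simpa using this
  exact Set.infinite_of_injective_forall_mem hinj hmem (h.finite m)

lemma exists_mem_trajectory {t : ℝ} (ht : 0 ≤ t) : ∃ y : ℝ, !₂[t, y] ∈ trajectory θ S := by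
  classical
  have hex := h.exists_coord_gt hθ hθ' t
  have hpos : Nat.find hex ≠ 0 := by
    intro h0
    have := Nat.find_spec hex
    rw [h0] at this
    simp [waypoint] at this
    linarith
  obtain ⟨n, hn⟩ := Nat.exists_eq_succ_of_ne_zero hpos
  have h1 : t < waypoint θ S (n + 1) 0 := by
    have := Nat.find_spec hex
    rwa [hn] at this
  have h2 : waypoint θ S n 0 ≤ t := by
    have := Nat.find_min hex (m := n) (by omega)
    exact not_lt.1 this
  set a := waypoint θ S n
  set b := waypoint θ S (n + 1)
  have hab : 0 < b 0 - a 0 := by linarith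
  refine ⟨a 1 + (t - a 0) / (b 0 - a 0) * (b 1 - a 1), Set.mem_iUnion.2 ⟨n, ?_⟩⟩
  rw [segment_eq_image']
  refine ⟨(t - a 0) / (b 0 - a 0), ⟨div_nonneg (by linarith) hab.le, ?_⟩, ?_⟩
  · rw [div_le_one hab]; linarith
  · ext i
    fin_cases i
    · simp only [Fin.zero_eta, PiLp.add_apply, PiLp.smul_apply, PiLp.sub_apply, smul_eq_mul,
        Matrix.cons_val_zero]
      rw [div_mul_cancel₀ _ hab.ne']; ring
    · simp [a, b]

lemma displacement_mem {t : ℝ} (ht : 0 ≤ t) : !₂[t, displacement θ S t] ∈ trajectory θ S := by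
  have hex := h.exists_mem_trajectory hθ hθ' ht
  rw [displacement, dif_pos hex]
  exact hex.choose_spec

/-- The trajectory is the graph of a `1`-Lipschitz function. -/
lemma abs_sub_le_of_mem_trajectory {p : Plane} (hp : p ∈ trajectory θ S) (n : ℕ) :
    |p 1 - waypoint θ S n 1| ≤ |p 0 - waypoint θ S n 0| := by
  obtain ⟨k, hk⟩ := Set.mem_iUnion.1 hp
  rw [segment_eq_image'] at hk
  obtain ⟨s, ⟨hs0, hs1⟩, rfl⟩ := hk
  have hstep := (step_mem_of_isSuccessor hθ hθ' (h.isSuccessor k)).1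
  have hsmul : ∀ {r : ℝ}, 0 ≤ r → ∀ {w : Plane}, w ∈ closedCone θ → r • w ∈ closedCone θ := by
    intro r hr w hw
    have hw' : |w 1| ≤ Real.tan θ * w 0 := hw
    simp only [closedCone, Set.mem_ofPred_eq, PiLp.smul_apply, smul_eq_mul, abs_mul,
      abs_of_nonneg hr]
    nlinarith
  rcases le_or_gt n k with hnk | hnk
  · have h1 := add_mem_closedCone (h.sub_mem_closedCone hθ hθ' hnk) (hsmul hs0 hstep)
    have h2 := (abs_le_of_mem_closedCone hθ hθ' h1).trans (le_abs_self _)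
    refine (congrArg abs ?_).le.trans (h2.trans (congrArg abs ?_).le) <;> simp <;> ring
  · have h1 := add_mem_closedCone (h.sub_mem_closedCone hθ hθ' hnk)
      (hsmul (sub_nonneg.2 hs1) hstep)
    have h2 := (abs_le_of_mem_closedCone hθ hθ' h1).trans (le_abs_self _)
    rw [abs_sub_comm, abs_sub_comm _ (waypoint θ S n 0)]
    refine (congrArg abs ?_).le.trans (h2.trans (congrArg abs ?_).le) <;> simp <;> ring

end IsNavigable

variable {Ω : Type*} [MeasurableSpace Ω] {P : Measure Ω} {Φ : Ω → Set Plane}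

lemma IsPoissonProcess.ae_inter_cone_nonempty (hΦ : IsPoissonProcess P l Φ) (hl : 0 < l)
    (hθ : 0 < θ) (hθ' : θ ≤ Real.pi / 4) (a : Plane) : ∀ᵐ ω ∂P, (Φ ω ∩ cone θ a).Nonempty := by
  rw [ae_iff]
  refine le_antisymm ?_ zero_le
  have hbound : ∀ m : ℕ, P {ω | ¬ (Φ ω ∩ cone θ a).Nonempty}
      ≤ ENNReal.ofReal (Real.exp (-(l * (θ * (m : ℝ) ^ 2)))) := by
    intro m
    set b : Plane := a + EuclideanSpace.single 0 (m : ℝ)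
    have hdist : dist b a = m := by simp [b, dist_eq_norm]
    have hvol := volume_openSector hθ (lt_pi_div_two hθ') a b
    rw [hdist] at hvol
    have hv := hΦ.prob_void hl.le (isOpen_openSector θ a b).measurableSet
      (by rw [hvol]; exact ENNReal.ofReal_ne_top)
    rw [Measure.real, hvol, ENNReal.toReal_ofReal (by positivity)] at hv
    rw [← hv]
    refine measure_mono fun ω hω => ?_
    simp only [Set.mem_ofPred_eq, Set.encard_eq_zero, Set.not_nonempty_iff_eq_empty] at hω ⊢
    refine Set.eq_empty_of_subset_empty (hω ▸ Set.inter_subset_inter_right _ fun z hz => ?_)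
    rw [mem_cone_iff hθ (lt_pi_div_two hθ')]
    refine ⟨?_, hz.1.le⟩
    exact pos_of_mul_pos_right ((abs_nonneg _).trans_lt hz.1)
      (tan_pos_of_lt hθ (lt_pi_div_two hθ')).le
  have hlim : Tendsto (fun m : ℕ => ENNReal.ofReal (Real.exp (-(l * (θ * (m : ℝ) ^ 2)))))
      atTop (𝓝 0) := by
    rw [← ENNReal.ofReal_zero]
    refine ENNReal.tendsto_ofReal (Real.tendsto_exp_neg_atTop_nhds_zero.comp ?_)
    exact (((tendsto_pow_atTop two_ne_zero).comp tendsto_natCast_atTop_atTop).const_mul_atTop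
      hθ).const_mul_atTop hl
  exact ge_of_tendsto' hlim hbound

lemma IsPoissonProcess.ae_isNavigable (hΦ : IsPoissonProcess P l Φ) (hl : 0 < l)
    (hθ : 0 < θ) (hθ' : θ ≤ Real.pi / 4) : ∀ᵐ ω ∂P, IsNavigable θ (Φ ω) := by
  have h1 : ∀ᵐ ω ∂P, ∀ m : ℕ, (Φ ω ∩ Metric.closedBall 0 m).Finite := by
    rw [ae_all_iff]
    exact fun m => hΦ.ae_finite Metric.isClosed_closedBall.measurableSet
      measure_closedBall_lt_top.ne
  have h2 : ∀ᵐ ω ∂P, ∀ m : ℕ, (Φ ω ∩ cone θ (EuclideanSpace.single 0 (m : ℝ))).Nonempty := by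
    rw [ae_all_iff]
    exact fun m => hΦ.ae_inter_cone_nonempty hl hθ hθ' _
  filter_upwards [h1, h2] with ω hω1 hω2
  refine IsNavigable.of_cone hω1 fun v => ?_
  have hk := tan_pos_of_lt hθ (lt_pi_div_two hθ')
  obtain ⟨m, hm⟩ := exists_nat_ge (v 0 + |v 1| / Real.tan θ)
  refine (hω2 m).mono (Set.inter_subset_inter_right _ fun z hz => ?_)
  rw [mem_cone_iff hθ (lt_pi_div_two hθ')] at hz ⊢
  simp at hz
  have h3 : |v 1| ≤ (m - v 0) * Real.tan θ := by
    rw [← div_le_iff₀ hk]; linarith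
  have h4 : 0 ≤ |v 1| / Real.tan θ := by positivity
  refine ⟨by linarith, ?_⟩
  have := abs_sub (z 1) (v 1)
  nlinarith

end Waypoints

section Chernoff

/-! ### Exponential bounds for the waypoints -/

variable {l θ : ℝ}

lemma lintegral_pathDensity_mul_exp (hl : 0 < l) (hθ : 0 < θ) {n : ℕ} {γ : Fin n → Plane}
    {c : Fin n → ℝ} :
    ∫⁻ v : Fin n → Plane, pathDensity l θ v * ENNReal.ofReal (Real.exp
        (∑ i, (inner ℝ (γ i) (step v i) + c i * ‖step v i‖)))
      = ENNReal.ofReal (∏ i, ∫ w, Real.exp (inner ℝ (γ i) w + c i * ‖w‖) ∂stepMeasure l θ) := by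
  have hm : ∀ i, Measurable fun w : Plane =>
      ENNReal.ofReal (Real.exp (inner ℝ (γ i) w + c i * ‖w‖)) := fun i => by fun_prop
  have h := lintegral_prod_step (n := n) (g := fun i w => stepDensity l θ w *
    ENNReal.ofReal (Real.exp (inner ℝ (γ i) w + c i * ‖w‖)))
    fun i => (measurable_stepDensity l θ).mul (hm i)
  rw [ENNReal.ofReal_prod_of_nonneg fun i _ => integral_nonneg fun w => (Real.exp_pos _).le]
  refine Eq.trans ?_ (h.trans ?_)
  · refine lintegral_congr fun v => ?_
    rw [Finset.prod_mul_distrib, Real.exp_sum,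
      ENNReal.ofReal_prod_of_nonneg fun i _ => (Real.exp_pos _).le, pathDensity]
  · refine Finset.prod_congr rfl fun i _ => ?_
    rw [← lintegral_stepMeasure (hm i),
      ofReal_integral_eq_lintegral_ofReal (integrable_exp_inner_add hl hθ _ _)]
    exact ae_of_all _ fun w => (Real.exp_pos _).le

lemma lintegral_pathDensity_exp_inner (hl : 0 < l) (hθ : 0 < θ) (n : ℕ) (γ : Plane) :
    ∫⁻ v : Fin (n + 1) → Plane, pathDensity l θ v *
        ENNReal.ofReal (Real.exp (inner ℝ γ (v (Fin.last n))))
      = ENNReal.ofReal (laplace l θ γ ^ (n + 1)) := by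
  have h := lintegral_pathDensity_mul_exp (l := l) (n := n + 1) hl hθ
    (γ := fun _ => γ) (c := fun _ => 0)
  simp only [zero_mul, add_zero, Finset.prod_const, Finset.card_univ, Fintype.card_fin] at h
  rw [laplace, ← h]
  refine lintegral_congr fun v => ?_
  rw [← inner_sum, sum_step]

lemma lintegral_pathDensity (hl : 0 < l) (hθ : 0 < θ) (hθ' : θ ≤ Real.pi / 4) (n : ℕ) :
    ∫⁻ v : Fin n → Plane, pathDensity l θ v = 1 := by
  have := lintegral_prod_step (n := n) (g := fun _ => stepDensity l θ)
    fun _ => measurable_stepDensity l θ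
  refine this.trans ?_
  simp [lintegral_stepDensity hl hθ hθ']

variable {Ω : Type*} [MeasurableSpace Ω] {P : Measure Ω} {Φ : Ω → Set Plane}

lemma pred_waypoint (S : Set Plane) {n : ℕ} (i : Fin n) :
    pred (fun j : Fin n => waypoint θ S (j + 1)) i = waypoint θ S i := by
  rw [pred]
  split_ifs with h
  · rw [h]; rfl
  · congr 1
    simp only
    omega

lemma prob_waypoints_mem_le [IsProbabilityMeasure P] (hΦ : IsPoissonProcess P l Φ) (hl : 0 < l)
    (hθ : 0 < θ) (hθ' : θ ≤ Real.pi / 4) {n : ℕ} {T : Set (Fin n → Plane)} (hT : IsClosed T) :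
    P {ω | (fun j : Fin n => waypoint θ (Φ ω) (j + 1)) ∈ T} ≤ ∫⁻ v in T, pathDensity l θ v := by
  refine le_trans (measure_mono_ae ?_) (prob_path_le hΦ hl.le hθ hθ' hT)
  filter_upwards [hΦ.ae_isNavigable hl hθ hθ'] with ω hω hT
  refine ⟨_, hT, fun i => ?_⟩
  rw [pred_waypoint]
  exact hω.isSuccessor i

/-- Chernoff bound for a waypoint and the subsequent step. -/
lemma prob_waypoint_exp_le [IsProbabilityMeasure P] (hΦ : IsPoissonProcess P l Φ) (hl : 0 < l)
    (hθ : 0 < θ) (hθ' : θ ≤ Real.pi / 4) (n : ℕ) (γ : Plane) (c a : ℝ) :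
    P {ω | a ≤ inner ℝ γ (waypoint θ (Φ ω) n)
        + c * ‖waypoint θ (Φ ω) (n + 1) - waypoint θ (Φ ω) n‖}
      ≤ ENNReal.ofReal (Real.exp (-a) * (laplace l θ γ ^ n *
        ∫ w, Real.exp (c * ‖w‖) ∂stepMeasure l θ)) := by
  have hcont : Continuous fun v : Fin (n + 1) → Plane =>
      inner ℝ γ (pred v (Fin.last n)) + c * ‖step v (Fin.last n)‖ := by
    have := continuous_pred (n := n + 1) (Fin.last n)
    have := continuous_step (n := n + 1) (Fin.last n)
    fun_prop
  let T : Set (Fin (n + 1) → Plane) :=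
    {v | a ≤ inner ℝ γ (pred v (Fin.last n)) + c * ‖step v (Fin.last n)‖}
  have hT : IsClosed T := isClosed_le continuous_const hcont
  have h1 := prob_waypoints_mem_le hΦ hl hθ hθ' hT
  have hset : {ω | (fun j : Fin (n + 1) => waypoint θ (Φ ω) (j + 1)) ∈ T}
      = {ω | a ≤ inner ℝ γ (waypoint θ (Φ ω) n)
        + c * ‖waypoint θ (Φ ω) (n + 1) - waypoint θ (Φ ω) n‖} := by
    ext ω
    simp only [T, Set.mem_ofPred_eq, step, pred_waypoint, Fin.val_last]
  rw [hset] at h1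
  refine h1.trans ?_
  have h2 := lintegral_pathDensity_mul_exp (l := l) (n := n + 1) hl hθ
    (γ := Fin.snoc (fun _ => γ) 0) (c := Fin.snoc (fun _ => 0) c)
  have hpred : ∀ v : Fin (n + 1) → Plane,
      pred v (Fin.last n) = ∑ i : Fin n, step v i.castSucc := by
    intro v
    have := sum_step v
    rw [Fin.sum_univ_castSucc, step] at this
    exact (eq_sub_of_add_eq this).trans (by abel) |>.symm
  have hsum : ∀ v : Fin (n + 1) → Plane,
      ∑ i, (inner ℝ ((Fin.snoc (fun _ => γ) 0 : Fin (n + 1) → Plane) i) (step v i)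
        + (Fin.snoc (fun _ => 0) c : Fin (n + 1) → ℝ) i * ‖step v i‖)
      = inner ℝ γ (pred v (Fin.last n)) + c * ‖step v (Fin.last n)‖ := by
    intro v
    rw [Fin.sum_univ_castSucc, hpred, inner_sum]
    simp
  have hprod : ∏ i, ∫ w, Real.exp (inner ℝ ((Fin.snoc (fun _ => γ) 0 : Fin (n + 1) → Plane) i) w
        + (Fin.snoc (fun _ => 0) c : Fin (n + 1) → ℝ) i * ‖w‖) ∂stepMeasure l θ
      = laplace l θ γ ^ n * ∫ w, Real.exp (c * ‖w‖) ∂stepMeasure l θ := by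
    rw [Fin.prod_univ_castSucc]
    simp [laplace]
  simp only [hsum, hprod] at h2
  have hm : Measurable fun v : Fin (n + 1) → Plane => pathDensity l θ v * ENNReal.ofReal
      (Real.exp (inner ℝ γ (pred v (Fin.last n)) + c * ‖step v (Fin.last n)‖)) :=
    (measurable_pathDensity l θ _).mul
      (ENNReal.measurable_ofReal.comp (Real.measurable_exp.comp hcont.measurable))
  rw [ENNReal.ofReal_mul (Real.exp_pos _).le, ← h2, ← lintegral_const_mul _ hm,
    ← lintegral_indicator hT.measurableSet]
  refine lintegral_mono fun v => ?_
  by_cases hv : v ∈ T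
  · rw [Set.indicator_of_mem hv, mul_left_comm, ← ENNReal.ofReal_mul (Real.exp_pos _).le,
      ← Real.exp_add]
    refine le_mul_of_one_le_right zero_le ?_
    rw [ENNReal.one_le_ofReal, Real.one_le_exp_iff]
    have : a ≤ _ := hv
    linarith
  · rw [Set.indicator_of_notMem hv]; exact zero_le

/-- Lower bound for the probability that the waypoints follow a given velocity, obtained by
tilting. -/
lemma eventually_le_prob_waypoint [IsProbabilityMeasure P] (hΦ : IsPoissonProcess P l Φ)
    (hl : 0 < l) (hθ : 0 < θ) (hθ' : θ ≤ Real.pi / 4) {u γ : Plane}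
    (hγ : ∀ γ', logMGF l θ γ - inner ℝ γ u ≤ logMGF l θ γ' - inner ℝ γ' u) {ε : ℝ} (hε : 0 < ε) :
    ∀ᶠ n : ℕ in atTop,
      ENNReal.ofReal (1 / 2 * Real.exp (n * (logMGF l θ γ - inner ℝ γ u - ‖γ‖ * ε)))
        ≤ P {ω | ‖waypoint θ (Φ ω) n - (n : ℝ) • u‖ < n * ε} := by
  let e : Bool × Bool → Plane := fun b =>
    EuclideanSpace.single (if b.1 then 0 else 1) (if b.2 then 1 else -1)
  have he : ∀ x : Plane, ∀ r, 2 * r ≤ ‖x‖ → ∃ b, r ≤ inner ℝ (e b) x := by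
    intro x r hr
    by_contra! hcon
    have h1 := hcon (true, true)
    have h2 := hcon (true, false)
    have h3 := hcon (false, true)
    have h4 := hcon (false, false)
    simp [e, inner_plane] at h1 h2 h3 h4
    have h5 : |x 0| < r := abs_lt.2 ⟨by linarith, h1⟩
    have h6 : |x 1| < r := abs_lt.2 ⟨by linarith, h3⟩
    have : ‖x‖ < 2 * r := by
      rw [EuclideanSpace.norm_eq, Fin.sum_univ_two, Real.sqrt_lt' (by linarith [abs_nonneg (x 0)])]
      simp only [Real.norm_eq_abs]
      have := pow_lt_pow_left₀ h5 (abs_nonneg _) two_ne_zero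
      have := pow_lt_pow_left₀ h6 (abs_nonneg _) two_ne_zero
      nlinarith [abs_nonneg (x 0)]
    linarith
  choose s hs hslt using fun b => exists_tilt_lt hl hθ hθ' hγ (e b) (half_pos hε)
  let κ : Bool × Bool → ℝ := fun b =>
    logMGF l θ (γ + s b • e b) - logMGF l θ γ - s b * (inner ℝ (e b) u + ε / 2)
  have hκ : ∀ b, κ b < 0 := fun b => by have := hslt b; simp only [κ]; linarith
  have hsum : Tendsto (fun n : ℕ => ∑ b, Real.exp (n * κ b)) atTop (𝓝 0) := by
    rw [show (0 : ℝ) = ∑ _b : Bool × Bool, (0 : ℝ) by simp]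
    refine tendsto_finsetSum _ fun b _ => Real.tendsto_exp_atBot.comp ?_
    exact tendsto_natCast_atTop_atTop.atTop_mul_const_of_neg (hκ b)
  filter_upwards [hsum.eventually (ge_mem_nhds (by norm_num : (0 : ℝ) < 1 / 2)),
    eventually_ge_atTop 1] with n hn hn1
  obtain ⟨m, rfl⟩ : ∃ m, n = m + 1 := ⟨n - 1, by omega⟩
  set N : ℝ := ((m + 1 : ℕ) : ℝ) with hN
  have hN0 : 0 < N := by rw [hN]; positivity
  set J := logMGF l θ γ
  let T : Set (Fin (m + 1) → Plane) := {v | N * ε ≤ ‖v (Fin.last m) - N • u‖}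
  have hT : IsClosed T := isClosed_le continuous_const (by fun_prop)
  have hbad := prob_waypoints_mem_le hΦ hl hθ hθ' hT
  set A : Set Ω := {ω | ‖waypoint θ (Φ ω) (m + 1) - N • u‖ < N * ε} with hA
  have hcompl : {ω | (fun j : Fin (m + 1) => waypoint θ (Φ ω) (j + 1)) ∈ T} = Aᶜ := by
    ext ω
    simp [T, A]
  rw [hcompl] at hbad
  have hPA : ∫⁻ v in Tᶜ, pathDensity l θ v ≤ P A := by
    have h1 : (1 : ENNReal) ≤ P A + P Aᶜ := by
      rw [← measure_univ (μ := P)]; exact measure_univ_le_add_compl A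
    have h2 := lintegral_add_compl (μ := volume)
      (pathDensity l θ : (Fin (m + 1) → Plane) → ENNReal) hT.measurableSet
    rw [lintegral_pathDensity hl hθ hθ'] at h2
    have hTfin : ∫⁻ v in T, pathDensity l θ v ≠ ⊤ := by
      intro h; rw [h] at h2; simp at h2
    have h3 : (∫⁻ v in T, pathDensity l θ v) + ∫⁻ v in Tᶜ, pathDensity l θ v
        ≤ (∫⁻ v in T, pathDensity l θ v) + P A := by
      rw [h2, add_comm]
      exact h1.trans (by gcongr)
    exact (ENNReal.add_le_add_iff_left hTfin).1 h3
  refine le_trans ?_ hPA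
  let E : (Fin (m + 1) → Plane) → ENNReal := fun v =>
    pathDensity l θ v * ENNReal.ofReal (Real.exp (inner ℝ γ (v (Fin.last m))))
  have hEm : Measurable E := (measurable_pathDensity l θ _).mul (by fun_prop)
  have hE : ∫⁻ v, E v = ENNReal.ofReal (Real.exp (N * J)) := by
    rw [lintegral_pathDensity_exp_inner hl hθ, ← exp_logMGF hl hθ hθ', ← Real.exp_nat_mul]
  have hgood : ENNReal.ofReal (Real.exp (-(N * inner ℝ γ u + N * ε * ‖γ‖))) * ∫⁻ v in Tᶜ, E v
      ≤ ∫⁻ v in Tᶜ, pathDensity l θ v := by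
    rw [← lintegral_const_mul _ hEm]
    refine setLIntegral_mono' hT.measurableSet.compl fun v hv => ?_
    simp only [E]
    rw [mul_left_comm, ← ENNReal.ofReal_mul (Real.exp_pos _).le, ← Real.exp_add]
    refine mul_le_of_le_one_right' ?_
    rw [ENNReal.ofReal_le_one, Real.exp_le_one_iff]
    have hv' : ‖v (Fin.last m) - N • u‖ < N * ε := not_le.1 hv
    have h1 := real_inner_le_norm γ (v (Fin.last m) - N • u)
    rw [inner_sub_right, real_inner_smul_right] at h1
    have h2 := mul_le_mul_of_nonneg_left hv'.le (norm_nonneg γ)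
    linarith
  have hbadE : ∫⁻ v in T, E v ≤ ENNReal.ofReal (Real.exp (N * J) * ∑ b, Real.exp (N * κ b)) := by
    have hb : ∀ b, ∫⁻ v, E v * ENNReal.ofReal
        (Real.exp (s b * (inner ℝ (e b) (v (Fin.last m)) - N * (inner ℝ (e b) u + ε / 2))))
        = ENNReal.ofReal (Real.exp (N * J) * Real.exp (N * κ b)) := by
      intro b
      have h1 : ∀ v : Fin (m + 1) → Plane, E v * ENNReal.ofReal
          (Real.exp (s b * (inner ℝ (e b) (v (Fin.last m)) - N * (inner ℝ (e b) u + ε / 2))))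
          = ENNReal.ofReal (Real.exp (-(s b * (N * (inner ℝ (e b) u + ε / 2))))) *
            (pathDensity l θ v *
              ENNReal.ofReal (Real.exp (inner ℝ (γ + s b • e b) (v (Fin.last m))))) := by
        intro v
        simp only [E]
        rw [mul_assoc, mul_left_comm (ENNReal.ofReal _) (pathDensity l θ v),
          ← ENNReal.ofReal_mul (Real.exp_pos _).le, ← ENNReal.ofReal_mul (Real.exp_pos _).le,
          ← Real.exp_add, ← Real.exp_add, inner_add_left, real_inner_smul_left]
        congr 3; ring
      simp only [h1]
      have hm : Measurable fun v : Fin (m + 1) → Plane => pathDensity l θ v *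
          ENNReal.ofReal (Real.exp (inner ℝ (γ + s b • e b) (v (Fin.last m)))) :=
        (measurable_pathDensity l θ _).mul (by fun_prop)
      rw [lintegral_const_mul _ hm, lintegral_pathDensity_exp_inner hl hθ, ← exp_logMGF hl hθ hθ', ← Real.exp_nat_mul,
        ← ENNReal.ofReal_mul (Real.exp_pos _).le, ← Real.exp_add, ← Real.exp_add]
      congr 2
      simp only [κ]; ring
    rw [Finset.mul_sum, ENNReal.ofReal_sum_of_nonneg (fun b _ => by positivity)]
    simp only [← hb]
    have hm : ∀ b, Measurable fun v : Fin (m + 1) → Plane => E v * ENNReal.ofReal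
        (Real.exp (s b * (inner ℝ (e b) (v (Fin.last m)) - N * (inner ℝ (e b) u + ε / 2)))) :=
      fun b => hEm.mul (by fun_prop)
    rw [← lintegral_finsetSum _ fun b _ => hm b,
      ← lintegral_indicator hT.measurableSet]
    refine lintegral_mono fun v => ?_
    by_cases hv : v ∈ T
    · rw [Set.indicator_of_mem hv]
      have hv' : N * ε ≤ ‖v (Fin.last m) - N • u‖ := hv
      obtain ⟨b, hb⟩ := he (v (Fin.last m) - N • u) (N * ε / 2) (by linarith)
      rw [inner_sub_right, real_inner_smul_right] at hb
      refine le_trans ?_ (Finset.single_le_sum (f := fun b => E v * ENNReal.ofReal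
        (Real.exp (s b * (inner ℝ (e b) (v (Fin.last m)) - N * (inner ℝ (e b) u + ε / 2)))))
        (fun _ _ => zero_le) (Finset.mem_univ b))
      refine le_mul_of_one_le_right zero_le ?_
      rw [ENNReal.one_le_ofReal, Real.one_le_exp_iff]
      exact mul_nonneg (hs b).le (by linarith)
    · rw [Set.indicator_of_notMem hv]; exact zero_le
  have hhalf : ENNReal.ofReal (1 / 2 * Real.exp (N * J)) ≤ ∫⁻ v in Tᶜ, E v := by
    have h2 := lintegral_add_compl (μ := volume) E hT.measurableSet
    rw [hE] at h2
    have h3 : ∫⁻ v in T, E v ≤ ENNReal.ofReal (1 / 2 * Real.exp (N * J)) := by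
      refine hbadE.trans (ENNReal.ofReal_le_ofReal ?_)
      rw [mul_comm]
      exact mul_le_mul_of_nonneg_right hn (Real.exp_pos _).le
    have h4 : ENNReal.ofReal (1 / 2 * Real.exp (N * J)) + ENNReal.ofReal (1 / 2 * Real.exp (N * J))
        ≤ ENNReal.ofReal (1 / 2 * Real.exp (N * J)) + ∫⁻ v in Tᶜ, E v := by
      rw [← ENNReal.ofReal_add (by positivity) (by positivity), ← add_mul, add_halves, one_mul,
        ← h2]
      exact add_le_add_left h3 _
    exact (ENNReal.add_le_add_iff_left ENNReal.ofReal_ne_top).1 h4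
  refine le_trans (le_of_eq ?_) ((mul_le_mul_right hhalf _).trans hgood)
  rw [← ENNReal.ofReal_mul (Real.exp_pos _).le, mul_left_comm, ← Real.exp_add]
  congr 3; ring

end Chernoff

section LargeDeviations

/-! ### The large-deviation principle for the displacement -/

variable {l θ : ℝ} {Ω : Type*} [MeasurableSpace Ω] {P : Measure Ω} {Φ : Ω → Set Plane}

lemma abs_displacement_div_le {S : Set Plane} (h : IsNavigable θ S) (hθ : 0 < θ)
    (hθ' : θ ≤ Real.pi / 4) {t : ℝ} (ht : 0 < t) : |t⁻¹ * displacement θ S t| ≤ 1 := by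
  have h1 := h.abs_sub_le_of_mem_trajectory hθ hθ' (h.displacement_mem hθ hθ' ht.le) 0
  simp only [waypoint, Matrix.cons_val_zero, Matrix.cons_val_one, PiLp.zero_apply, sub_zero,
    abs_of_pos ht] at h1
  rw [abs_mul, abs_of_pos (inv_pos.2 ht), inv_mul_le_iff₀ ht, mul_one]
  exact h1

/-- The local upper bound at a point `x` with dual certificate `γ`. -/
lemma prob_displacement_near_le [IsProbabilityMeasure P] (hΦ : IsPoissonProcess P l Φ)
    (hl : 0 < l) (hθ : 0 < θ) (hθ' : θ ≤ Real.pi / 4) {γ : Plane} (hγ : logMGF l θ γ < 0)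
    {x δ a : ℝ} (ha : a + |γ 1| * δ ≤ γ 0 + γ 1 * x) {t : ℝ} (ht : 0 < t) :
    P {ω | |t⁻¹ * displacement θ (Φ ω) t - x| < δ}
      ≤ ENNReal.ofReal ((1 - laplace l θ γ)⁻¹ * (∫ w, Real.exp (‖γ‖ * ‖w‖) ∂stepMeasure l θ) *
        Real.exp (-(a * t))) := by
  have hZ0 := laplace_pos hl hθ hθ' γ
  have hZ1 : laplace l θ γ < 1 := by
    rw [← exp_logMGF hl hθ hθ', Real.exp_lt_one_iff]; exact hγ
  have hK : 0 ≤ ∫ w, Real.exp (‖γ‖ * ‖w‖) ∂stepMeasure l θ :=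
    integral_nonneg fun w => (Real.exp_pos _).le
  let A : ℕ → Set Ω := fun n => {ω | a * t ≤ inner ℝ γ (waypoint θ (Φ ω) n)
        + ‖γ‖ * ‖waypoint θ (Φ ω) (n + 1) - waypoint θ (Φ ω) n‖}
  have hsub : P {ω | |t⁻¹ * displacement θ (Φ ω) t - x| < δ} ≤ P (⋃ n, A n) := by
    refine measure_mono_ae ?_
    filter_upwards [hΦ.ae_isNavigable hl hθ hθ'] with ω hω hx
    obtain ⟨n, hn⟩ := Set.mem_iUnion.1 (hω.displacement_mem hθ hθ' ht.le)
    refine Set.mem_iUnion.2 ⟨n, ?_⟩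
    set y := displacement θ (Φ ω) t
    have hx' : |t⁻¹ * y - x| < δ := hx
    rw [segment_eq_image'] at hn
    obtain ⟨s, ⟨hs0, hs1⟩, hs⟩ := hn
    have h1 := congrArg (fun w => inner ℝ γ w) hs
    simp only [inner_add_right, real_inner_smul_right] at h1
    rw [inner_plane γ !₂[t, y]] at h1
    simp only [Matrix.cons_val_zero, Matrix.cons_val_one] at h1
    have h2 := real_inner_le_norm γ (waypoint θ (Φ ω) (n + 1) - waypoint θ (Φ ω) n)
    have h3 : s * inner ℝ γ (waypoint θ (Φ ω) (n + 1) - waypoint θ (Φ ω) n)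
        ≤ ‖γ‖ * ‖waypoint θ (Φ ω) (n + 1) - waypoint θ (Φ ω) n‖ := by
      refine (mul_le_mul_of_nonneg_left h2 hs0).trans (mul_le_of_le_one_left (by positivity) hs1)
    have h4 : -(|γ 1| * δ) ≤ γ 1 * (t⁻¹ * y - x) := by
      have h5 := neg_abs_le (γ 1 * (t⁻¹ * y - x))
      rw [abs_mul] at h5
      have h6 := mul_le_mul_of_nonneg_left hx'.le (abs_nonneg (γ 1))
      linarith
    have h7 : a ≤ γ 0 + γ 1 * (t⁻¹ * y) := by linarith
    have h8 := mul_le_mul_of_nonneg_right h7 ht.le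
    have h9 : (γ 0 + γ 1 * (t⁻¹ * y)) * t = γ 0 * t + γ 1 * y := by field_simp
    have : a * t ≤ inner ℝ γ (waypoint θ (Φ ω) n)
        + ‖γ‖ * ‖waypoint θ (Φ ω) (n + 1) - waypoint θ (Φ ω) n‖ := by linarith
    exact this
  refine hsub.trans ((measure_iUnion_le _).trans ?_)
  refine (ENNReal.tsum_le_tsum fun n =>
    prob_waypoint_exp_le hΦ hl hθ hθ' n γ ‖γ‖ (a * t)).trans ?_
  have hgeom := hasSum_geometric_of_lt_one hZ0.le hZ1
  have hsum := (hgeom.mul_right (∫ w, Real.exp (‖γ‖ * ‖w‖) ∂stepMeasure l θ)).mul_left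
    (Real.exp (-(a * t)))
  rw [← ENNReal.ofReal_tsum_of_nonneg (fun n => by positivity) hsum.summable, hsum.tsum_eq,
    mul_comm (Real.exp _)]

lemma limsup_le_of_eventually_le {p : ℝ → ENNReal} {C a : ℝ} (hC : 0 < C)
    (h : ∀ᶠ t in atTop, p t ≤ ENNReal.ofReal (C * Real.exp (-(a * t)))) :
    limsup (fun t : ℝ => ((t⁻¹ : ℝ) : EReal) * ENNReal.log (p t)) atTop ≤ ((-a : ℝ) : EReal) := by
  have hlim : Tendsto (fun t : ℝ => ((t⁻¹ * Real.log C - a : ℝ) : EReal)) atTop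
      (𝓝 ((-a : ℝ) : EReal)) := by
    refine (continuous_coe_real_ereal.tendsto _).comp ?_
    have := (tendsto_inv_atTop_zero (𝕜 := ℝ)).mul_const (Real.log C) |>.sub_const a
    simpa using this
  rw [← hlim.limsup_eq]
  refine limsup_le_limsup ?_
  filter_upwards [h, eventually_gt_atTop 0] with t ht ht0
  have h1 := ENNReal.log_monotone ht
  rw [ENNReal.log_ofReal_of_pos (by positivity)] at h1
  refine (mul_le_mul_of_nonneg_left h1 (by exact_mod_cast (inv_pos.2 ht0).le)).trans ?_
  rw [← EReal.coe_mul, EReal.coe_le_coe_iff, Real.log_mul hC.ne' (Real.exp_pos _).ne',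
    Real.log_exp]
  apply le_of_eq
  field_simp
  ring

lemma limsup_displacement_le [IsProbabilityMeasure P] (hΦ : IsPoissonProcess P l Φ)
    (hl : 0 < l) (hθ : 0 < θ) (hθ' : θ ≤ Real.pi / 4) {F : Set ℝ} (hF : IsClosed F) :
    limsup (fun t : ℝ => ((t⁻¹ : ℝ) : EReal) *
        ENNReal.log (P {ω | t⁻¹ * displacement θ (Φ ω) t ∈ F})) atTop
      ≤ - ⨅ x ∈ F, rate l θ x := by
  have key : ∀ a : ℝ, (a : EReal) < ⨅ x ∈ F, rate l θ x →
      limsup (fun t : ℝ => ((t⁻¹ : ℝ) : EReal) *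
        ENNReal.log (P {ω | t⁻¹ * displacement θ (Φ ω) t ∈ F})) atTop ≤ ((-a : ℝ) : EReal) := by
    intro a ha
    have hax : ∀ x ∈ F, (a : EReal) < rate l θ x := fun x hx =>
      ha.trans_le (iInf₂_le x hx)
    have hcomp : IsCompact (Set.Icc (-1 : ℝ) 1 ∩ F) := isCompact_Icc.inter_right hF
    have hbound : ∃ C : ℝ, 0 < C ∧ ∀ᶠ t in atTop,
        P {ω | t⁻¹ * displacement θ (Φ ω) t ∈ Set.Icc (-1 : ℝ) 1 ∩ F}
          ≤ ENNReal.ofReal (C * Real.exp (-(a * t))) := by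
      refine hcomp.induction_on (p := fun S => ∃ C : ℝ, 0 < C ∧ ∀ᶠ t in atTop,
        P {ω | t⁻¹ * displacement θ (Φ ω) t ∈ S} ≤ ENNReal.ofReal (C * Real.exp (-(a * t))))
        ?_ ?_ ?_ ?_
      · exact ⟨1, one_pos, by simp⟩
      · rintro s s' hss ⟨C, hC, h⟩
        refine ⟨C, hC, h.mono fun t ht => ?_⟩
        have hsub : {ω | t⁻¹ * displacement θ (Φ ω) t ∈ s}
            ⊆ {ω | t⁻¹ * displacement θ (Φ ω) t ∈ s'} := fun ω hω => hss hω
        exact (measure_mono hsub).trans ht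
      · rintro s s' ⟨C, hC, h⟩ ⟨C', hC', h'⟩
        refine ⟨C + C', by positivity, ?_⟩
        filter_upwards [h, h'] with t ht ht'
        rw [add_mul, ENNReal.ofReal_add (by positivity) (by positivity)]
        exact (measure_union_le _ _).trans (add_le_add ht ht')
      · intro x hx
        obtain ⟨γ, hγ, hlt⟩ := exists_of_lt_rate hl hθ hθ' (hax x hx.2)
        set δ := (γ 0 + γ 1 * x - a) / (|γ 1| + 1) with hδ
        have hden : 0 < |γ 1| + 1 := by positivity
        have hδ0 : 0 < δ := div_pos (by linarith) hden
        have haδ : a + |γ 1| * δ ≤ γ 0 + γ 1 * x := by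
          have : (|γ 1| + 1) * δ = γ 0 + γ 1 * x - a := mul_div_cancel₀ _ hden.ne'
          linarith
        have hZ1 : laplace l θ γ < 1 := by
          rw [← exp_logMGF hl hθ hθ', Real.exp_lt_one_iff]; exact hγ
        refine ⟨Metric.ball x δ, mem_nhdsWithin_of_mem_nhds (Metric.ball_mem_nhds x hδ0),
          (1 - laplace l θ γ)⁻¹ * (∫ w, Real.exp (‖γ‖ * ‖w‖) ∂stepMeasure l θ), ?_, ?_⟩
        · have := isProbabilityMeasure_stepMeasure hl hθ hθ'
          exact mul_pos (inv_pos.2 (by linarith)) (integral_exp_pos (integrable_exp_mul_norm hl hθ _))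
        · filter_upwards [eventually_gt_atTop 0] with t ht
          exact prob_displacement_near_le hΦ hl hθ hθ' hγ haδ ht
    obtain ⟨C, hC, h⟩ := hbound
    refine limsup_le_of_eventually_le hC ?_
    filter_upwards [h, eventually_gt_atTop 0] with t ht ht0
    refine le_trans (measure_mono_ae ?_) ht
    filter_upwards [hΦ.ae_isNavigable hl hθ hθ'] with ω hω hF
    exact ⟨abs_le.1 (abs_displacement_div_le hω hθ hθ' ht0), hF⟩
  by_contra! hcon
  obtain ⟨b, hb1, hb2⟩ := EReal.lt_iff_exists_real_btwn.1 hcon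
  have h1 : ((-b : ℝ) : EReal) < ⨅ x ∈ F, rate l θ x := by
    rw [EReal.coe_neg]; exact EReal.neg_lt_comm.1 hb1
  have h2 := key _ h1
  rw [neg_neg] at h2
  exact absurd h2 (not_le.2 hb2)

/-- The trajectory follows its waypoints. -/
lemma abs_displacement_sub_le {S : Set Plane} (h : IsNavigable θ S) (hθ : 0 < θ)
    (hθ' : θ ≤ Real.pi / 4) {t : ℝ} (ht : 0 ≤ t) (n : ℕ) (y : ℝ) {r : ℝ}
    (hr : ‖waypoint θ S n - !₂[t, y]‖ ≤ r) : |displacement θ S t - y| ≤ 2 * r := by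
  have h1 := h.abs_sub_le_of_mem_trajectory hθ hθ' (h.displacement_mem hθ hθ' ht) n
  simp only [Matrix.cons_val_zero, Matrix.cons_val_one] at h1
  have h2 : ∀ i, |(waypoint θ S n - !₂[t, y]) i| ≤ r := fun i =>
    (PiLp.norm_apply_le _ i).trans hr
  have h3 := h2 0
  have h4 := h2 1
  simp only [PiLp.sub_apply, Matrix.cons_val_zero, Matrix.cons_val_one] at h3 h4
  rw [abs_sub_comm] at h3
  have h5 := abs_sub_le (displacement θ S t) (waypoint θ S n 1) y
  linarith

lemma eventually_le_prob_displacement [IsProbabilityMeasure P] (hΦ : IsPoissonProcess P l Φ)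
    (hl : 0 < l) (hθ : 0 < θ) (hθ' : θ ≤ Real.pi / 4) {x β r δ : ℝ} (hβ : 0 < β) (hr : 0 < r)
    (hδ : 0 < δ) {γ : Plane} {u : Plane} (hu : u = !₂[1 / β, x / β])
    (hγ : ∀ γ', logMGF l θ γ - inner ℝ γ u ≤ logMGF l θ γ' - inner ℝ γ' u) :
    ∀ᶠ t : ℝ in atTop, ENNReal.ofReal (1 / 2 *
        Real.exp (-(β * (inner ℝ γ u - logMGF l θ γ + δ) * t)))
      ≤ P {ω | |t⁻¹ * displacement θ (Φ ω) t - x| < r} := by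
  set c := inner ℝ γ u - logMGF l θ γ
  have hc : 0 ≤ c := by
    have := hγ 0
    rw [logMGF_zero hl hθ hθ', inner_zero_left] at this
    simp only [c]; linarith
  set ε := min (δ / (‖γ‖ + 1)) (r / (8 * β)) with hε
  have hε0 : 0 < ε := lt_min (by positivity) (by positivity)
  have hε1 : ‖γ‖ * ε ≤ δ := by
    have h1 : (‖γ‖ + 1) * ε ≤ δ := by
      rw [mul_comm, ← le_div_iff₀ (by positivity)]; exact min_le_left _ _
    linarith
  have hε2 : 8 * (β * ε) ≤ r := by
    have h1 : ε * (8 * β) ≤ r := by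
      rw [← le_div_iff₀ (by positivity)]; exact min_le_right _ _
    linarith
  have hfloor : Tendsto (fun t : ℝ => ⌊β * t⌋₊) atTop atTop :=
    tendsto_nat_floor_atTop.comp (tendsto_id.const_mul_atTop hβ)
  filter_upwards [hfloor.eventually (eventually_le_prob_waypoint hΦ hl hθ hθ' hγ hε0),
    eventually_gt_atTop 0, eventually_gt_atTop (8 * ‖u‖ / r)] with t hprob ht0 htu
  set n := ⌊β * t⌋₊
  have hn1 : (n : ℝ) ≤ β * t := Nat.floor_le (by positivity)
  have hn2 : β * t < n + 1 := Nat.lt_floor_add_one _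
  refine le_trans (ENNReal.ofReal_le_ofReal ?_) (hprob.trans (measure_mono_ae ?_))
  · refine mul_le_mul_of_nonneg_left (Real.exp_le_exp.2 ?_) (by norm_num)
    have h1 : logMGF l θ γ - inner ℝ γ u - ‖γ‖ * ε = -(c + ‖γ‖ * ε) := by simp only [c]; ring
    rw [h1, mul_neg, neg_le_neg_iff]
    calc (n : ℝ) * (c + ‖γ‖ * ε) ≤ (β * t) * (c + δ) := by gcongr
      _ = _ := by ring
  · filter_upwards [hΦ.ae_isNavigable hl hθ hθ'] with ω hω hA
    have hA' : ‖waypoint θ (Φ ω) n - (n : ℝ) • u‖ < n * ε := hA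
    have htarget : (!₂[t, x * t] : Plane) = (β * t) • u := by
      rw [hu]
      ext i
      fin_cases i <;> simp <;> field_simp
    have hdist : ‖waypoint θ (Φ ω) n - !₂[t, x * t]‖ ≤ β * t * ε + ‖u‖ := by
      have h1 : waypoint θ (Φ ω) n - !₂[t, x * t]
          = (waypoint θ (Φ ω) n - (n : ℝ) • u) + ((n : ℝ) - β * t) • u := by
        rw [htarget, sub_smul]; abel
      rw [h1]
      refine (norm_add_le _ _).trans (add_le_add (hA'.le.trans (by gcongr)) ?_)
      rw [norm_smul, Real.norm_eq_abs]
      refine mul_le_of_le_one_left (norm_nonneg _) (abs_le.2 ⟨by linarith, by linarith⟩)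
    have h2 := abs_displacement_sub_le hω hθ hθ' ht0.le n (x * t) hdist
    have h3 : t⁻¹ * displacement θ (Φ ω) t - x = t⁻¹ * (displacement θ (Φ ω) t - x * t) := by
      field_simp
    have h4 : |t⁻¹ * displacement θ (Φ ω) t - x| < r := by
      rw [h3, abs_mul, abs_of_pos (inv_pos.2 ht0), inv_mul_lt_iff₀ ht0]
      rw [div_lt_iff₀ hr] at htu
      have := mul_le_mul_of_nonneg_left hε2 ht0.le
      nlinarith
    exact h4

lemma le_liminf_of_eventually_le {p : ℝ → ENNReal} {C a : ℝ} (hC : 0 < C)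
    (h : ∀ᶠ t in atTop, ENNReal.ofReal (C * Real.exp (-(a * t))) ≤ p t) :
    ((-a : ℝ) : EReal) ≤ liminf (fun t : ℝ => ((t⁻¹ : ℝ) : EReal) * ENNReal.log (p t)) atTop := by
  have hlim : Tendsto (fun t : ℝ => ((t⁻¹ * Real.log C - a : ℝ) : EReal)) atTop
      (𝓝 ((-a : ℝ) : EReal)) := by
    refine (continuous_coe_real_ereal.tendsto _).comp ?_
    have := (tendsto_inv_atTop_zero (𝕜 := ℝ)).mul_const (Real.log C) |>.sub_const a
    simpa using this
  rw [← hlim.liminf_eq]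
  refine liminf_le_liminf ?_
  filter_upwards [h, eventually_gt_atTop 0] with t ht ht0
  have h1 := ENNReal.log_monotone ht
  rw [ENNReal.log_ofReal_of_pos (by positivity)] at h1
  refine le_trans ?_ (mul_le_mul_of_nonneg_left h1 (by exact_mod_cast (inv_pos.2 ht0).le))
  rw [← EReal.coe_mul, EReal.coe_le_coe_iff, Real.log_mul hC.ne' (Real.exp_pos _).ne',
    Real.log_exp]
  apply le_of_eq
  field_simp
  ring

lemma le_liminf_displacement [IsProbabilityMeasure P] (hΦ : IsPoissonProcess P l Φ)
    (hl : 0 < l) (hθ : 0 < θ) (hθ' : θ ≤ Real.pi / 4) {O : Set ℝ} (hO : IsOpen O) :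
    - ⨅ x ∈ O, rate l θ x ≤ liminf (fun t : ℝ => ((t⁻¹ : ℝ) : EReal) *
        ENNReal.log (P {ω | t⁻¹ * displacement θ (Φ ω) t ∈ O})) atTop := by
  rw [EReal.neg_le]
  refine le_iInf₂ fun x hx => le_iInf fun ⟨β, hβ⟩ => ?_
  simp only
  set u : Plane := !₂[1 / β, x / β] with hu
  by_cases htop : stepRate l θ u = ⊤
  · rw [htop, EReal.coe_mul_top_of_pos hβ]; exact le_top
  obtain ⟨γ, hγ⟩ := exists_minimizer hl hθ hθ' (mem_openCone_of_stepRate_ne_top hl hθ hθ' htop)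
  obtain ⟨r, hr, hball⟩ := Metric.isOpen_iff.1 hO x hx
  have key : ∀ δ > 0, ((-(β * (inner ℝ γ u - logMGF l θ γ + δ)) : ℝ) : EReal) ≤
      liminf (fun t : ℝ => ((t⁻¹ : ℝ) : EReal) *
        ENNReal.log (P {ω | t⁻¹ * displacement θ (Φ ω) t ∈ O})) atTop := by
    intro δ hδ
    refine le_liminf_of_eventually_le one_half_pos ?_
    filter_upwards [eventually_le_prob_displacement hΦ hl hθ hθ' hβ hr hδ hu hγ] with t ht
    exact ht.trans (measure_mono fun ω hω => hball hω)
  have hlim : Tendsto (fun δ : ℝ => ((-(β * (inner ℝ γ u - logMGF l θ γ + δ)) : ℝ) : EReal))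
      (𝓝[>] 0) (𝓝 ((-(β * (inner ℝ γ u - logMGF l θ γ + 0)) : ℝ) : EReal)) := by
    refine (continuous_coe_real_ereal.tendsto _).comp (Tendsto.mono_left ?_ nhdsWithin_le_nhds)
    exact (by fun_prop : Continuous fun δ : ℝ =>
      -(β * (inner ℝ γ u - logMGF l θ γ + δ))).tendsto 0
  have h1 := le_of_tendsto hlim (eventually_nhdsWithin_of_forall fun δ hδ => key δ hδ)
  rw [add_zero, EReal.coe_neg] at h1
  refine (EReal.neg_le.1 h1).trans ?_
  rw [EReal.coe_mul]
  exact mul_le_mul_of_nonneg_left (le_stepRate γ u) (by exact_mod_cast hβ.le)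

end LargeDeviations

end Navigation

theorem theorem2p4 (l θ : ℝ) (hl : 0 < l) (hθ : 0 < θ) (hθ' : θ ≤ Real.pi / 4)
    {Ω : Type*} [MeasurableSpace Ω] (P : Measure Ω) [IsProbabilityMeasure P]
    (Φ : Ω → Set Navigation.Plane) (hΦ : Navigation.IsPoissonProcess P l Φ) :
    Navigation.IsLDP P (fun t ω => t⁻¹ * Navigation.displacement θ (Φ ω) t) (fun t => t)
        (Navigation.rate l θ) ∧
      ∀ x : ℝ, Navigation.rate l θ x
        = ((Real.sqrt l : ℝ) : EReal) * Navigation.rate 1 θ x :=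
  ⟨{ nonneg := Navigation.rate_nonneg hl hθ hθ'
     lowerSemicontinuous := Navigation.lowerSemicontinuous_rate hl hθ hθ'
     upper := fun _ hF => Navigation.limsup_displacement_le hΦ hl hθ hθ' hF
     lower := fun _ hO => Navigation.le_liminf_displacement hΦ hl hθ hθ' hO },
    Navigation.rate_scale hl⟩
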